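/- **Theorem 4.1.** Let $(Z_t)_{t\in\mathbb Z}$ be i.i.d. real random variables with $\mathbb E Z_0=0$, $\mathbb E Z_0^2=1$, and let $\mathcal F_t=\sigma(Z_k;k\le t)$. Let $p,q\ge 0$ be integers, $\Theta\subset\mathbb R^d$, and let $\{g_\theta:\theta\in\Theta\}$ be functions $\mathbb R^p\times[0,\infty)^q\to[0,\infty)$. Consider the model $$X_t=\sigma_tZ_t,\qquad \sigma_t^2=g_\theta(X_{t-1},\dots,X_{t-p};\sigma_{t-1}^2,\dots,\sigma_{t-q}^2)\quad\text{a.s.},\qquad t\in\mathbb Z,$$ where $\sigma_t\ge 0$ is $\mathcal F_{t-1}$-measurable. Let $K\subset\Theta$ be compact, $\theta_0\in K$, let $\mathbb C(K,[0,\infty)^q)$ carry the metric of $\|s\|_K=\sup_{\theta\in K}|s(\theta)|$ ($|\cdot|$ Euclidean) and its Borel $\sigma$-field, and suppose that $x\mapsto g_\theta(x,s)$ is measurable for all $\theta\in K$ and $s$. For a map $\phi$ of a metric space into itself put $\Lambda(\phi)=\sup_{x\ne y}d(\phi(x),\phi(y))/d(x,y)$. Assume: 1. The model with $\theta=\theta_0$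 has an (a.s.) unique stationary ergodic solution $((X_t,\sigma_t^2))_{t\in\mathbb Z}$, and $\mathbb E\log^+\sigma_0^2<\infty$. 2. The map $(\theta,s)\mapsto g_\theta(x,s)$ is continuous on $K\times[0,\infty)^q$ for every $x\in\mathbb R^p$. With $\mathbf X_t=(X_t,\dots,X_{t-p+1})$, let the random maps $\Phi_t:\mathbb C(K,[0,\infty)^q)\to\mathbb C(K,[0,\infty)^q)$ be given by $$[\Phi_t(s)](\theta)=\bigl(g_\theta(\mathbf X_t,s(\theta)),s_1(\theta),\dots,s_{q-1}(\theta)\bigr).$$ For a fixed initial value $\varsigma\in[0,\infty)^q$ (regarded as a constant function on $K$) one has $\mathbb E\log^+\|\Phi_0(\varsigma)\|_K<\infty$; moreover $\mathbb E\log^+\Lambda(\Phi_0)<\infty$, and there is an integer $r\ge1$ with $\mathbb E\log\Lambda(\Phi_0\circ\Phi_{-1}\circ\dots\circ\Phi_{-r+1})<0$ (the value $-\infty$ being allowed). 3. There is $\underline g>0$ with $g_\theta(x,s)\ge\underline g$ for all $\theta\in K$, $(x,s)\in\mathbb R^p\times[0,\infty)^q$. 4. Let $(\mathbf h_t)_{t\in\mathbb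 Z}$ be the stationary solution in $\mathbb C(K,[0,\infty)^q)$ of $\mathbf h_{t+1}=\Phi_t(\mathbf h_t)$ a.s., $t\in\mathbb Z$, and let $h_t(\theta)=g_\theta(\mathbf X_{t-1},\mathbf h_{t-1}(\theta))$, which for $q\ge1$ is a.s. the first coordinate of $\mathbf h_t(\theta)$. Then for all $\theta\in K$: $h_0(\theta)=\sigma_0^2$ a.s. if and only if $\theta=\theta_0$. Define $\hat{\mathbf h}_0=\varsigma$, $\hat{\mathbf h}_{t+1}=\Phi_t(\hat{\mathbf h}_t)$ for $t\ge0$, and $\hat h_t(\theta)=g_\theta(\mathbf X_{t-1},\hat{\mathbf h}_{t-1}(\theta))$ for $t\ge1$ (for $q\ge1$ the first coordinate of $\hat{\mathbf h}_t(\theta)$), and $$\hat L_n(\theta)=-\frac12\sum_{t=1}^n\left(\frac{X_t^2}{\hat h_t(\theta)}+\log\hat h_t(\theta)\right),\qquad\theta\in K.$$ Let $\hat\theta_n\in K$, $n\ge1$, be such that $\hat\theta_n$ maximizes $\hat L_n$ over $K$ almost surely (the Gaussian quasi maximum likelihood estimator). Then $\hat\theta_n\to\theta_0$ almost surely as $n\to\infty$.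 -/

import Mathlib

open MeasureTheory ProbabilityTheory Filter Topology TopologicalSpace
open scoped NNReal ENNReal

/-! ### Random sequences -/

/-- The left shift on two-sided sequences. -/
def seqShift {E : Type*} (v : ℤ → E) : ℤ → E := fun t => v (t + 1)

/-- The law of a two-sided random sequence, a measure on the product space `E^ℤ`. -/
noncomputable def seqLaw {Ω E : Type*} [MeasurableSpace Ω] [MeasurableSpace E]
    (μ : Measure Ω) (v : ℤ → Ω → E) : Measure (ℤ → E) :=
  μ.map fun ω t => v t ω

/-- `v` is a (strictly) stationary sequence of random elements: the shift preserves its law. -/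
def IsStationarySeq {Ω E : Type*} [MeasurableSpace Ω] [MeasurableSpace E]
    (μ : Measure Ω) (v : ℤ → Ω → E) : Prop :=
  (∀ t, Measurable (v t)) ∧ MeasurePreserving seqShift (seqLaw μ v) (seqLaw μ v)

/-- `v` is a stationary ergodic sequence of random elements: the shift preserves its law and is
ergodic for it. -/
def IsStationaryErgodicSeq {Ω E : Type*} [MeasurableSpace Ω] [MeasurableSpace E]
    (μ : Measure Ω) (v : ℤ → Ω → E) : Prop :=
  (∀ t, Measurable (v t)) ∧ Ergodic seqShift (seqLaw μ v)

/-- An i.i.d. sequence of real random variables with mean zero and unit second moment. -/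
structure IsIIDNoise {Ω : Type*} [MeasurableSpace Ω] (μ : Measure Ω) (Z : ℤ → Ω → ℝ) : Prop where
  measurable : ∀ t, Measurable (Z t)
  indep : iIndepFun Z μ
  identDistrib : ∀ t, IdentDistrib (Z t) (Z 0) μ μ
  mean : ∫ ω, Z 0 ω ∂μ = 0
  second_moment : ∫ ω, Z 0 ω ^ 2 ∂μ = 1

/-- The σ-field generated by the random variables `Z k`, `k ≤ t`. -/
@[reducible] def pastField {Ω : Type*} (Z : ℤ → Ω → ℝ) (t : ℤ) : MeasurableSpace Ω :=
  ⨆ k, ⨆ (_ : k ≤ t), MeasurableSpace.comap (Z k) inferInstance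

/-! ### Logarithmic moments and Lipschitz coefficients -/

/-- `E[log⁺ Y]` for a `[0, ∞]`-valued `Y` (with `log 0 = -∞`). -/
noncomputable def meanLogPos {Ω : Type*} [MeasurableSpace Ω] (μ : Measure Ω) (Y : Ω → ℝ≥0∞) :
    ℝ≥0∞ :=
  ∫⁻ ω, (ENNReal.log (Y ω)).toENNReal ∂μ

/-- `E[log⁻ Y]` for a `[0, ∞]`-valued `Y` (with `log 0 = -∞`). -/
noncomputable def meanLogNeg {Ω : Type*} [MeasurableSpace Ω] (μ : Measure Ω) (Y : Ω → ℝ≥0∞) :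
    ℝ≥0∞ :=
  ∫⁻ ω, (-ENNReal.log (Y ω)).toENNReal ∂μ

/-- `E[log Y] < 0`, where `E[log Y] = E[log⁺ Y] - E[log⁻ Y]` is well defined in `[-∞, ∞)` and may
equal `-∞`. (The strict inequality forces `E[log⁺ Y] < ∞`.) -/
def MeanLogNegative {Ω : Type*} [MeasurableSpace Ω] (μ : Measure Ω) (Y : Ω → ℝ≥0∞) : Prop :=
  meanLogPos μ Y < meanLogNeg μ Y

/-- The Lipschitz coefficient `sup_{x ≠ y} d(φ x, φ y) / d(x, y)`; it is finite exactly for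
Lipschitz maps. -/
noncomputable def lipCoeff {E : Type*} [MetricSpace E] (φ : E → E) : ℝ≥0∞ :=
  ⨆ (x : E) (y : E) (_ : x ≠ y), edist (φ x) (φ y) / edist x y

/-- The `r`-fold iterate of past and present maps, `φ_t ∘ φ_{t-1} ∘ ⋯ ∘ φ_{t-r+1}`. -/
def pastIterate {E : Type*} (φ : ℤ → E → E) : ℤ → ℕ → E → E
  | _, 0 => id
  | t, r + 1 => φ t ∘ pastIterate φ (t - 1) r

/-! ### The model -/

/-- The space `[0, ∞)^q` with the Euclidean metric. -/
abbrev VolState (q : ℕ) : Type := PiLp 2 fun _ : Fin q => ℝ≥0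

/-- The vector `(X_t, X_{t-1}, …, X_{t-p+1})`. -/
def obsVec {Ω : Type*} (p : ℕ) (X : ℤ → Ω → ℝ) (t : ℤ) (ω : Ω) : Fin p → ℝ :=
  fun i => X (t - (i : ℕ)) ω

/-- The vector `(σ_t², σ_{t-1}², …, σ_{t-q+1}²)`. -/
noncomputable def volVec {Ω : Type*} (q : ℕ) (σ : ℤ → Ω → ℝ≥0) (t : ℤ) (ω : Ω) : VolState q :=
  WithLp.toLp 2 fun i => σ (t - (i : ℕ)) ω ^ 2

/-- `(X, σ)` solves `X_t = σ_t Z_t`, `σ_t² = γ(X_{t-1}, …, X_{t-p}; σ_{t-1}², …, σ_{t-q}²)` almost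
surely for all `t ∈ ℤ`, where `σ_t ≥ 0` is measurable with respect to the σ-field generated by
`Z_k`, `k ≤ t - 1`. -/
structure IsModelSolution {Ω : Type*} [MeasurableSpace Ω] (μ : Measure Ω) {p q : ℕ}
    (Z : ℤ → Ω → ℝ) (γ : (Fin p → ℝ) → VolState q → ℝ≥0)
    (X : ℤ → Ω → ℝ) (σ : ℤ → Ω → ℝ≥0) : Prop where
  measurable_obs : ∀ t, Measurable (X t)
  measurable_vol : ∀ t, Measurable[pastField Z (t - 1)] (σ t)
  obs_eq : ∀ t, ∀ᵐ ω ∂μ, X t ω = σ t ω * Z t ω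
  vol_eq : ∀ t, ∀ᵐ ω ∂μ, σ t ω ^ 2 = γ (obsVec p X (t - 1) ω) (volVec q σ (t - 1) ω)

/-- A solution of the model for which `((X_t, σ_t²))` is stationary and ergodic. -/
def IsStationaryErgodicSolution {Ω : Type*} [MeasurableSpace Ω] (μ : Measure Ω) {p q : ℕ}
    (Z : ℤ → Ω → ℝ) (γ : (Fin p → ℝ) → VolState q → ℝ≥0)
    (X : ℤ → Ω → ℝ) (σ : ℤ → Ω → ℝ≥0) : Prop :=
  IsModelSolution μ Z γ X σ ∧ IsStationaryErgodicSeq μ fun t ω => (X t ω, σ t ω ^ 2)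

/-- `(X, σ)` is, up to almost sure equality, the only stationary ergodic solution. -/
def IsUniqueStationaryErgodicSolution {Ω : Type*} [MeasurableSpace Ω] (μ : Measure Ω) {p q : ℕ}
    (Z : ℤ → Ω → ℝ) (γ : (Fin p → ℝ) → VolState q → ℝ≥0)
    (X : ℤ → Ω → ℝ) (σ : ℤ → Ω → ℝ≥0) : Prop :=
  IsStationaryErgodicSolution μ Z γ X σ ∧
    ∀ (X' : ℤ → Ω → ℝ) (σ' : ℤ → Ω → ℝ≥0), IsStationaryErgodicSolution μ Z γ X' σ' →
      ∀ t, ∀ᵐ ω ∂μ, X' t ω = X t ω ∧ σ' t ω = σ t ω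

/-! ### The stochastic recurrence equation on `C(K, [0, ∞)^q)` -/

/-- Spaces of continuous maps carry their Borel σ-field. -/
instance contMapMeasurableSpace {α β : Type*} [TopologicalSpace α] [TopologicalSpace β] :
    MeasurableSpace C(α, β) :=
  borel _

/-- The vector `(v, s_1, …, s_{q-1})`. -/
noncomputable def pushState {q : ℕ} (v : ℝ≥0) (s : VolState q) : VolState q :=
  WithLp.toLp 2 fun i => if (i : ℕ) = 0 then v else s ⟨i - 1, by omega⟩

theorem continuous_pushState {q : ℕ} :
    Continuous fun a : ℝ≥0 × VolState q => pushState a.1 a.2 := by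
  refine (PiLp.continuous_toLp 2 _).comp (continuous_pi fun i => ?_)
  by_cases h : (i : ℕ) = 0
  · simpa [h] using continuous_fst
  · simp only [h, if_false]
    exact (PiLp.continuous_apply 2 _ _).comp continuous_snd

section SRE

variable {d p q : ℕ} {Θ : Set (EuclideanSpace ℝ (Fin d))}

/-- The map `[Φ(s)](θ) = (g_θ(x, s(θ)), s_1(θ), …, s_{q-1}(θ))`, `θ ∈ K`, on `C(K, [0, ∞)^q)`
(equipped with the supremum distance). -/
noncomputable def volMap (g : Θ → (Fin p → ℝ) → VolState q → ℝ≥0) (K : Compacts Θ)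
    (hg : ∀ x, Continuous fun a : K × VolState q => g a.1 x a.2) (x : Fin p → ℝ)
    (s : C(K, VolState q)) : C(K, VolState q) where
  toFun θ := pushState (g θ x (s θ)) (s θ)
  continuous_toFun :=
    continuous_pushState.comp
      (((hg x).comp (continuous_id.prodMk s.continuous)).prodMk s.continuous)

/-- The random maps `Φ_t`, i.e. `volMap` at `x = (X_t, …, X_{t-p+1})`. -/
noncomputable def sreMap {Ω : Type*} (g : Θ → (Fin p → ℝ) → VolState q → ℝ≥0) (K : Compacts Θ)
    (hg : ∀ x, Continuous fun a : K × VolState q => g a.1 x a.2) (X : ℤ → Ω → ℝ)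
    (t : ℤ) (ω : Ω) : C(K, VolState q) → C(K, VolState q) :=
  volMap g K hg (obsVec p X t ω)

/-- `(h_t)_{t ∈ ℤ}` is a stationary sequence of random elements of `C(K, [0, ∞)^q)` that solves
`h_{t+1} = Φ_t(h_t)` almost surely for all `t ∈ ℤ`. -/
def IsStationarySRESolution {Ω : Type*} [MeasurableSpace Ω] (μ : Measure Ω)
    (g : Θ → (Fin p → ℝ) → VolState q → ℝ≥0) (K : Compacts Θ)
    (hg : ∀ x, Continuous fun a : K × VolState q => g a.1 x a.2) (X : ℤ → Ω → ℝ)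
    (h : ℤ → Ω → C(K, VolState q)) : Prop :=
  IsStationarySeq μ h ∧ ∀ t, ∀ᵐ ω ∂μ, h (t + 1) ω = sreMap g K hg X t ω (h t ω)

/-- The recursion started at the constant function `ς`: `ĥ_0 = ς`, `ĥ_{t+1} = Φ_t(ĥ_t)`, for the
vector functions `(ĥ_t, …, ĥ_{t-q+1})`. -/
noncomputable def volHat {Ω : Type*} (g : Θ → (Fin p → ℝ) → VolState q → ℝ≥0) (K : Compacts Θ)
    (hg : ∀ x, Continuous fun a : K × VolState q => g a.1 x a.2) (X : ℤ → Ω → ℝ)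
    (ς : VolState q) : ℕ → Ω → C(K, VolState q)
  | 0, _ => ContinuousMap.const K ς
  | t + 1, ω => sreMap g K hg X t ω (volHat g K hg X ς t ω)

/-- If `s : C(K, [0, ∞)^q)` is the vector of volatility functions at time `t`, this is the scalar
squared volatility function at time `t + 1`, namely `θ ↦ g_θ(X_t, …, X_{t-p+1}; s(θ))`. For
`q ≥ 1` it is the first coordinate of `Φ_t(s)`; in this form it also makes sense for `q = 0`. -/
def nextVol {Ω : Type*} (g : Θ → (Fin p → ℝ) → VolState q → ℝ≥0) (K : Compacts Θ)
    (X : ℤ → Ω → ℝ) (t : ℤ) (ω : Ω) (s : C(K, VolState q)) (θ : K) : ℝ≥0 :=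
  g θ (obsVec p X t ω) (s θ)

theorem nextVol_eq_first_coord {Ω : Type*} (g : Θ → (Fin p → ℝ) → VolState q → ℝ≥0)
    (K : Compacts Θ) (hg : ∀ x, Continuous fun a : K × VolState q => g a.1 x a.2)
    (X : ℤ → Ω → ℝ) (t : ℤ) (ω : Ω) (s : C(K, VolState q)) (θ : K) (hq : 0 < q) :
    nextVol g K X t ω s θ = sreMap g K hg X t ω s θ ⟨0, hq⟩ := by
  simp [nextVol, sreMap, volMap, pushState]

/-- The Gaussian quasi log-likelihood
`L̂_n(θ) = -(1/2) ∑_{t=1}^n (X_t² / ĥ_t(θ) + log ĥ_t(θ))`, `θ ∈ K`; the sum is indexed by `t - 1`,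
and `ĥ_{t+1}(θ) = g_θ(X_t, …, X_{t-p+1}; ĥ_t(θ), …, ĥ_{t-q+1}(θ))`. -/
noncomputable def quasiLogLik {Ω : Type*} (g : Θ → (Fin p → ℝ) → VolState q → ℝ≥0)
    (K : Compacts Θ) (hg : ∀ x, Continuous fun a : K × VolState q => g a.1 x a.2)
    (X : ℤ → Ω → ℝ) (ς : VolState q) (n : ℕ) (ω : Ω) (θ : K) : ℝ :=
  -(1 / 2) * ∑ t ∈ Finset.range n,
    (X ((t : ℤ) + 1) ω ^ 2 / (nextVol g K X t ω (volHat g K hg X ς t ω) θ : ℝ)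
      + Real.log (nextVol g K X t ω (volHat g K hg X ς t ω) θ : ℝ))

/-- `θ̂_n`, `n ≥ 1`, is a quasi maximum likelihood estimator: a `K`-valued maximizer of `L̂_n`
over `K`, almost surely. -/
def IsQMLE {Ω : Type*} [MeasurableSpace Ω] (μ : Measure Ω)
    (g : Θ → (Fin p → ℝ) → VolState q → ℝ≥0)
    (K : Compacts Θ) (hg : ∀ x, Continuous fun a : K × VolState q => g a.1 x a.2)
    (X : ℤ → Ω → ℝ) (ς : VolState q) (θhat : ℕ → Ω → K) : Prop :=
  ∀ n, 1 ≤ n → ∀ᵐ ω ∂μ, ∀ θ : K,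
    quasiLogLik g K hg X ς n ω θ ≤ quasiLogLik g K hg X ς n ω (θhat n ω)

end SRE

/-! Why the estimator is consistent. Let `h_t(θ)` be the stationary volatility and `ℓ_t(θ) = X_t² /
h_t(θ) + log h_t(θ)`. Both `h_0(θ)` and `σ_0` are, up to null sets, functions of the noise before
time 0, and `Z_0` is independent of that past with `E Z_0² = 1`; hence `E ℓ_0(θ) = E[σ_0² / h_0(θ) +
log h_0(θ)]`. Since `u - log u` is smallest only at `u = 1`, this expectation is minimal exactly
when `h_0(θ) = σ_0²` a.s., that is, by identifiability, at `θ₀` (`lintegral_contrast_lt`). The lower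
bound on `g` makes `ℓ_t - log c` nonnegative, so the expectations make sense even when infinite.

A Wald-type compactness argument turns this into convergence of every sequence that minimizes `∑
ℓ_t` up to a bounded error (`ae_forall_tendsto_of_contrast`). The likelihood actually maximized uses
the recursion started at `ς`. The contraction condition makes that recursion approach the stationary
one geometrically fast, while `X_t²` grows subexponentially, so the two sums differ by a bounded
amount, uniformly in `θ` (`ae_abs_quasiLogLik_add_le`).

Everything random is a functional of the shifted path of `(X, σ²)`, so the work is done on path
space under the ergodic shift. Only one-sided linear bounds on Birkhoff sums are needed, and these
follow from a maximal-function argument. -/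

/-! ### A one-sided pointwise ergodic theorem -/

/-- The running maximum `max (0, S_1 f, …, S_n f)` of the Birkhoff sums. -/
noncomputable def birkhoffMax {S : Type*} (τ : S → S) (f : S → ℝ) : ℕ → S → ℝ
  | 0, _ => 0
  | n + 1, x => max 0 (f x + birkhoffMax τ f n (τ x))

section Birkhoff

variable {S : Type*} {τ : S → S} {f : S → ℝ}

theorem birkhoffMax_nonneg (n : ℕ) (x : S) : 0 ≤ birkhoffMax τ f n x := by
  cases n with
  | zero => exact le_rfl
  | succ n => exact le_max_left _ _

theorem birkhoffSum_le_birkhoffMax (n : ℕ) (x : S) : birkhoffSum τ f n x ≤ birkhoffMax τ f n x := by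
  induction n generalizing x with
  | zero => simp [birkhoffMax]
  | succ n ih =>
    rw [birkhoffSum_succ']
    exact le_trans (by linarith [ih (τ x)]) (le_max_right _ _)

theorem birkhoffMax_le_succ (n : ℕ) (x : S) : birkhoffMax τ f n x ≤ birkhoffMax τ f (n + 1) x := by
  induction n generalizing x with
  | zero => exact le_max_left _ _
  | succ n ih =>
    simp only [birkhoffMax] at ih ⊢
    exact max_le_max le_rfl (by linarith [ih (τ x)])

theorem monotone_birkhoffMax (x : S) : Monotone fun n => birkhoffMax τ f n x :=
  monotone_nat_of_le_succ fun n => birkhoffMax_le_succ n x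

theorem bddAbove_birkhoffMax_comp (x : S) :
    BddAbove (Set.range fun n => birkhoffMax τ f n (τ x)) ↔
      BddAbove (Set.range fun n => birkhoffMax τ f n x) := by
  constructor
  · rintro ⟨C, hC⟩
    refine ⟨max 0 (f x + C), ?_⟩
    rintro _ ⟨n, rfl⟩
    refine (birkhoffMax_le_succ n x).trans (max_le_max le_rfl ?_)
    linarith [hC ⟨n, rfl⟩]
  · rintro ⟨C, hC⟩
    refine ⟨C - f x, ?_⟩
    rintro _ ⟨n, rfl⟩
    have h1 := hC ⟨n + 1, rfl⟩
    have h2 := (le_max_right 0 (f x + birkhoffMax τ f n (τ x))).trans h1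
    simp only
    linarith

variable [MeasurableSpace S] {P : Measure S}

theorem measurable_birkhoffMax (hτ : Measurable τ) (hf : Measurable f) (n : ℕ) :
    Measurable (birkhoffMax τ f n) := by
  induction n with
  | zero => exact measurable_const
  | succ n ih => exact measurable_const.max (hf.add (ih.comp hτ))

theorem integrable_birkhoffMax (hτ : MeasurePreserving τ P P) (hf : Integrable f P) (n : ℕ) :
    Integrable (birkhoffMax τ f n) P := by
  induction n with
  | zero => exact integrable_zero _ _ _
  | succ n ih => exact (integrable_zero _ _ _).sup (hf.add (hτ.integrable_comp_of_integrable ih))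

/-- Write `M_n` for the running maximum. Boundedness of `M_n` is a shift-invariant event, hence has
probability 0 or 1. If it failed a.s., then `M_{n+1} - M_n ∘ τ = max (-M_n ∘ τ) f` would tend to
`f`, dominated by `|f|`. Its integral is nonnegative because `M_n` increases and `τ` preserves `P`,
which would force `∫ f ≥ 0`. -/
theorem ae_birkhoffSum_bddAbove [IsProbabilityMeasure P] (hτ : Ergodic τ P) (hm : Measurable f)
    (hf : Integrable f P) (hneg : ∫ x, f x ∂P < 0) :
    ∀ᵐ x ∂P, ∃ C : ℝ, ∀ n, birkhoffSum τ f n x ≤ C := by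
  set A : Set S := {x | BddAbove (Set.range fun n => birkhoffMax τ f n x)} with hA
  have hAm : MeasurableSet A :=
    measurableSet_bddAbove_range fun n => measurable_birkhoffMax hτ.measurable hm n
  have hinv : τ ⁻¹' A = A := Set.ext fun x => bddAbove_birkhoffMax_comp x
  rcases hτ.toPreErgodic.ae_mem_or_ae_notMem hAm hinv with h | h
  · filter_upwards [h] with x hx
    obtain ⟨C, hC⟩ := hx
    exact ⟨C, fun n => (birkhoffSum_le_birkhoffMax n x).trans (hC ⟨n, rfl⟩)⟩
  · exfalso
    have hmp := hτ.toMeasurePreserving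
    have hMi := integrable_birkhoffMax hmp hf
    have hMti : ∀ n, Integrable (fun x => birkhoffMax τ f n (τ x)) P := fun n =>
      hmp.integrable_comp_of_integrable (hMi n)
    have hD : ∀ n, 0 ≤ ∫ x, (birkhoffMax τ f (n + 1) x - birkhoffMax τ f n (τ x)) ∂P := fun n => by
      rw [integral_sub (hMi _) (hMti n)]
      have : ∫ x, birkhoffMax τ f n (τ x) ∂P = ∫ x, birkhoffMax τ f n x ∂P := by
        conv_rhs => rw [← hmp.map_eq]
        refine (integral_map hmp.aemeasurable ?_).symm
        rw [hmp.map_eq]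
        exact (hMi n).aestronglyMeasurable
      rw [this, sub_nonneg]
      exact integral_mono (hMi _) (hMi _) fun x => birkhoffMax_le_succ n x
    have hlim : Tendsto (fun n => ∫ x, (birkhoffMax τ f (n + 1) x - birkhoffMax τ f n (τ x)) ∂P)
        atTop (𝓝 (∫ x, f x ∂P)) := by
      refine tendsto_integral_of_dominated_convergence (fun x => |f x|)
        (fun n => ((hMi _).sub (hMti n)).aestronglyMeasurable) hf.abs ?_ ?_
      · refine fun n => ae_of_all _ fun x => ?_
        have h0 := birkhoffMax_nonneg (τ := τ) (f := f) n (τ x)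
        rw [Real.norm_eq_abs]
        change |max 0 (f x + birkhoffMax τ f n (τ x)) - birkhoffMax τ f n (τ x)| ≤ |f x|
        rcases le_total 0 (f x + birkhoffMax τ f n (τ x)) with h1 | h1
        · rw [max_eq_right h1, add_sub_cancel_right]
        · rw [max_eq_left h1, zero_sub, abs_neg, abs_of_nonneg h0]
          exact le_trans (by linarith) (neg_le_abs (f x))
      · filter_upwards [h] with x hx
        have hx' : ¬ BddAbove (Set.range fun n => birkhoffMax τ f n (τ x)) :=
          fun hb => hx ((bddAbove_birkhoffMax_comp x).1 hb)
        have ht := tendsto_atTop_atTop_of_monotone' (monotone_birkhoffMax (f := f) (τ x)) hx'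
        refine tendsto_const_nhds.congr' ?_
        filter_upwards [ht.eventually_ge_atTop (-f x)] with n hn
        change f x = max 0 (f x + birkhoffMax τ f n (τ x)) - birkhoffMax τ f n (τ x)
        rw [max_eq_right (by linarith), add_sub_cancel_right]
    exact absurd (ge_of_tendsto' hlim hD) (not_le.2 hneg)

/-- Centre `f` slightly above its mean, so that the previous result applies; the countably many
margins `1 / (k + 1)` give one null set for all `ε`. -/
theorem ae_birkhoffSum_le [IsProbabilityMeasure P] (hτ : Ergodic τ P) (hm : Measurable f)
    (hf : Integrable f P) :
    ∀ᵐ x ∂P, ∀ ε > 0, ∃ C : ℝ, ∀ n : ℕ, birkhoffSum τ f n x ≤ C + n * (∫ y, f y ∂P + ε) := by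
  have key : ∀ k : ℕ, ∀ᵐ x ∂P, ∃ C : ℝ, ∀ n : ℕ,
      birkhoffSum τ (fun y => f y - (∫ y, f y ∂P + 1 / ((k : ℝ) + 1))) n x ≤ C := fun k => by
    refine ae_birkhoffSum_bddAbove hτ (hm.sub_const _) (hf.sub (integrable_const _)) ?_
    rw [integral_sub hf (integrable_const _)]
    simp only [integral_const, probReal_univ, one_smul]
    have : 0 < 1 / ((k : ℝ) + 1) := by positivity
    linarith
  filter_upwards [ae_all_iff.2 key] with x hx ε hε
  obtain ⟨k, hk⟩ := exists_nat_one_div_lt hε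
  obtain ⟨C, hC⟩ := hx k
  refine ⟨C, fun n => ?_⟩
  have h1 := hC n
  simp only [birkhoffSum, Finset.sum_sub_distrib, Finset.sum_const, Finset.card_range,
    nsmul_eq_mul] at h1 ⊢
  have h2 : (n : ℝ) * (1 / ((k : ℝ) + 1)) ≤ n * ε := by gcongr
  linarith

theorem ae_le_birkhoffSum [IsProbabilityMeasure P] (hτ : Ergodic τ P) (hm : Measurable f)
    (hf : Integrable f P) :
    ∀ᵐ x ∂P, ∀ ε > 0, ∃ C : ℝ, ∀ n : ℕ, n * (∫ y, f y ∂P - ε) - C ≤ birkhoffSum τ f n x := by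
  filter_upwards [ae_birkhoffSum_le hτ hm.neg hf.neg] with x hx ε hε
  obtain ⟨C, hC⟩ := hx ε hε
  refine ⟨C, fun n => ?_⟩
  have h1 := hC n
  rw [birkhoffSum_neg] at h1
  simp only [Pi.neg_apply, integral_neg] at h1
  linarith

/-- A sequence `b` of reals is bounded above sublinearly if `b n ≤ C_ε + ε n` for every `ε > 0`. -/
def IsSublinear (b : ℕ → ℝ) : Prop :=
  ∀ ε > 0, ∃ C : ℝ, ∀ n : ℕ, b n ≤ C + ε * n

/-- A single term is the difference of two consecutive Birkhoff sums, whose linear parts cancel up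
to `ε n`. -/
theorem ae_isSublinear [IsProbabilityMeasure P] (hτ : Ergodic τ P) (hm : Measurable f)
    (hf : Integrable f P) : ∀ᵐ x ∂P, IsSublinear fun n => f (τ^[n] x) := by
  filter_upwards [ae_birkhoffSum_le hτ hm hf, ae_le_birkhoffSum hτ hm hf] with x h1 h2 ε hε
  obtain ⟨C, hC⟩ := h1 (ε / 2) (by positivity)
  obtain ⟨C', hC'⟩ := h2 (ε / 2) (by positivity)
  refine ⟨C + C' + ∫ y, f y ∂P + ε / 2, fun n => ?_⟩
  have h3 := hC (n + 1)
  have h4 := hC' n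
  rw [birkhoffSum_succ] at h3
  push_cast at h3
  linarith

end Birkhoff

/-! ### Sublinear sequences and geometric decay -/

/-- Moving the window of `r` consecutive terms by one step replaces `a n` by `a (n + r)`, at the
cost of `exp (f n)`. Working with windows produces a Birkhoff sum along all times; sums along
multiples of `r` would need ergodicity of the `r`-th power of the shift, which may fail. -/
theorem prod_shift_le {r : ℕ} (hr : 1 ≤ r) {a f : ℕ → ℝ} (ha : ∀ n, 0 ≤ a n)
    (har : ∀ n, a (n + r) ≤ a n * Real.exp (f n)) (n : ℕ) :
    ∏ i ∈ Finset.range r, a (n + i) ≤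
      (∏ i ∈ Finset.range r, a i) * Real.exp (∑ k ∈ Finset.range n, f k) := by
  induction n with
  | zero => simp
  | succ n ih =>
    obtain ⟨s, rfl⟩ : ∃ s, r = s + 1 := ⟨r - 1, by omega⟩
    calc ∏ i ∈ Finset.range (s + 1), a (n + 1 + i)
        = (∏ i ∈ Finset.range s, a (n + (i + 1))) * a (n + (s + 1)) := by
          rw [Finset.prod_range_succ]
          simp only [add_assoc, add_comm 1]
      _ ≤ (∏ i ∈ Finset.range s, a (n + (i + 1))) * (a n * Real.exp (f n)) :=
          mul_le_mul_of_nonneg_left (har n) (Finset.prod_nonneg fun _ _ => ha _)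
      _ = (∏ i ∈ Finset.range (s + 1), a (n + i)) * Real.exp (f n) := by
          rw [Finset.prod_range_succ', add_zero, mul_assoc]
      _ ≤ _ := by
          rw [Finset.sum_range_succ, Real.exp_add, ← mul_assoc]
          exact mul_le_mul_of_nonneg_right ih (Real.exp_nonneg _)

theorem pow_shift_le {a b : ℕ → ℝ} (ha : ∀ n, 0 ≤ a n) (hb : ∀ n, a (n + 1) ≤ a n * Real.exp (b n))
    {n m : ℕ} {B : ℝ} (hB : 0 ≤ B) (hbB : ∀ i < m, b (n + i) ≤ B) {i : ℕ} (hi : i ≤ m) :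
    a (n + m) ≤ a (n + i) * Real.exp (m * B) := by
  have h : ∀ j, i + j ≤ m → a (n + (i + j)) ≤ a (n + i) * Real.exp (j * B) := by
    intro j
    induction j with
    | zero => simp
    | succ j ih =>
      intro hj
      calc a (n + (i + (j + 1))) ≤ a (n + (i + j)) * Real.exp (b (n + (i + j))) := hb _
        _ ≤ (a (n + i) * Real.exp (j * B)) * Real.exp B := by
          gcongr
          · exact mul_nonneg (ha _) (Real.exp_nonneg _)
          · exact ih (by omega)
          · exact hbB _ (by omega)
        _ = a (n + i) * Real.exp ((j + 1 : ℕ) * B) := by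
          rw [mul_assoc, ← Real.exp_add]; push_cast; ring_nf
  obtain ⟨j, rfl⟩ := Nat.exists_eq_add_of_le hi
  refine (h j le_rfl).trans (mul_le_mul_of_nonneg_left (Real.exp_le_exp.2 ?_) (ha _))
  gcongr
  omega

/-- The product over a window decays like `exp (-δ n)`. The one-step bounds compare `a (n + r)` with
every factor of the window at subexponential cost, so `a (n + r) ^ r` decays as well, and an `r`-th
root is taken. -/
theorem exists_geometric_bound {r : ℕ} (hr : 1 ≤ r) {a f b : ℕ → ℝ} (ha : ∀ n, 0 ≤ a n)
    (har : ∀ n, a (n + r) ≤ a n * Real.exp (f n)) (hab : ∀ n, a (n + 1) ≤ a n * Real.exp (b n))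
    (hb : IsSublinear b) {δ D : ℝ} (hδ : 0 < δ)
    (hf : ∀ n : ℕ, ∑ k ∈ Finset.range n, f k ≤ D - δ * n) :
    ∃ C ρ : ℝ, 0 ≤ C ∧ 0 < ρ ∧ ρ < 1 ∧ ∀ n, a n ≤ C * ρ ^ n := by
  have hr0 : (0 : ℝ) < r := by exact_mod_cast hr
  -- Each of the `r` factors costs at most `r` one-step bounds, so the total slope is `r²` times
  -- this one, namely `δ / 2`; half of the decay survives.
  obtain ⟨B, hB⟩ := hb (δ / (2 * r * r)) (by positivity)
  obtain ⟨B, hB, hB0⟩ : ∃ B : ℝ, (∀ n : ℕ, b n ≤ B + δ / (2 * r * r) * n) ∧ 0 ≤ B :=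
    ⟨max B 0, fun n => (hB n).trans (by gcongr; exact le_max_left _ _), le_max_right _ _⟩
  -- An exponential upper bound is used because the product may vanish and have no logarithm.
  obtain ⟨Q, hQ⟩ : ∃ Q : ℝ, ∏ i ∈ Finset.range r, a i ≤ Real.exp Q :=
    ⟨_, by linarith [Real.add_one_le_exp (∏ i ∈ Finset.range r, a i)]⟩
  set E : ℝ := (Q + D) / r + r * (B + δ / (2 * r * r) * r) with hE
  set ρ : ℝ := Real.exp (-(δ / (2 * r))) with hρ
  have hρ0 : 0 < ρ := Real.exp_pos _
  have hρ1 : ρ < 1 := by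
    rw [hρ, Real.exp_lt_one_iff]
    have : 0 < δ / (2 * r) := by positivity
    linarith
  have main : ∀ n : ℕ, a (n + r) ≤ Real.exp E * ρ ^ n := by
    intro n
    set Bn : ℝ := B + δ / (2 * r * r) * (n + r) with hBn
    have hBn0 : 0 ≤ Bn := by positivity
    have h1 : ∀ i ∈ Finset.range r, a (n + r) ≤ a (n + i) * Real.exp (r * Bn) := by
      intro i hi
      refine pow_shift_le ha hab hBn0 (fun j hj => (hB _).trans ?_) (Finset.mem_range.1 hi).le
      rw [hBn]
      push_cast
      gcongr
    have h2 : a (n + r) ^ r ≤ (Real.exp E * ρ ^ n) ^ r := by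
      calc a (n + r) ^ r = ∏ i ∈ Finset.range r, a (n + r) := by simp
        _ ≤ ∏ i ∈ Finset.range r, (a (n + i) * Real.exp (r * Bn)) :=
          Finset.prod_le_prod (fun _ _ => ha _) h1
        _ = (∏ i ∈ Finset.range r, a (n + i)) * Real.exp (r * (r * Bn)) := by
          rw [Finset.prod_mul_distrib, Finset.prod_const, Finset.card_range, ← Real.exp_nat_mul]
        _ ≤ (Real.exp Q * Real.exp (D - δ * n)) * Real.exp (r * (r * Bn)) := by
          gcongr
          refine (prod_shift_le hr ha har n).trans ?_
          gcongr
          exact hf n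
        _ = (Real.exp E * ρ ^ n) ^ r := by
          rw [hρ, ← Real.exp_nat_mul, ← Real.exp_add, ← Real.exp_add, ← Real.exp_add,
            ← Real.exp_nat_mul]
          congr 1
          rw [hE, hBn]
          field_simp
          ring
    exact le_of_pow_le_pow_left₀ (by omega) (by positivity) h2
  obtain ⟨A, hA⟩ : ∃ A : ℝ, ∀ i ∈ Finset.range r, a i ≤ A :=
    ⟨∑ i ∈ Finset.range r, a i, fun i hi => Finset.single_le_sum (f := a) (fun i _ => ha i) hi⟩
  have hA0 : 0 ≤ A := (ha 0).trans (hA 0 (Finset.mem_range.2 hr))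
  refine ⟨(Real.exp E + A) / ρ ^ r, ρ, by positivity, hρ0, hρ1, fun n => ?_⟩
  rw [div_mul_eq_mul_div, le_div_iff₀ (by positivity)]
  rcases lt_or_ge n r with h | h
  · have h3 : ρ ^ r ≤ ρ ^ n := pow_le_pow_of_le_one hρ0.le hρ1.le h.le
    have h4 := hA n (Finset.mem_range.2 h)
    calc a n * ρ ^ r ≤ A * ρ ^ n := mul_le_mul h4 h3 (by positivity) hA0
      _ ≤ (Real.exp E + A) * ρ ^ n := by gcongr; linarith [Real.exp_pos E]
  · obtain ⟨m, rfl⟩ := Nat.exists_eq_add_of_le' h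
    calc a (m + r) * ρ ^ r ≤ (Real.exp E * ρ ^ m) * ρ ^ r := by gcongr; exact main m
      _ ≤ (Real.exp E + A) * ρ ^ (m + r) := by
        rw [mul_assoc, ← pow_add]; gcongr; linarith

theorem exists_geometric_bound_ennreal {r : ℕ} (hr : 1 ≤ r) {a : ℕ → ℝ≥0∞} {f b : ℕ → ℝ}
    (ha0 : a 0 ≠ ∞) (har : ∀ n, a (n + r) ≤ a n * ENNReal.ofReal (Real.exp (f n)))
    (hab : ∀ n, a (n + 1) ≤ a n * ENNReal.ofReal (Real.exp (b n)))
    (hb : IsSublinear b) {δ D : ℝ} (hδ : 0 < δ)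
    (hf : ∀ n : ℕ, ∑ k ∈ Finset.range n, f k ≤ D - δ * n) :
    ∃ C ρ : ℝ, 0 ≤ C ∧ 0 < ρ ∧ ρ < 1 ∧ ∀ n, a n ≤ ENNReal.ofReal (C * ρ ^ n) := by
  have hfin : ∀ n, a n ≠ ∞ := by
    intro n
    induction n with
    | zero => exact ha0
    | succ n ih => exact ne_top_of_le_ne_top (ENNReal.mul_ne_top ih ENNReal.ofReal_ne_top) (hab n)
  have key : ∀ n m c, a m ≤ a n * ENNReal.ofReal (Real.exp c) →
      (a m).toReal ≤ (a n).toReal * Real.exp c := fun n m c h => by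
    have := ENNReal.toReal_mono (ENNReal.mul_ne_top (hfin n) ENNReal.ofReal_ne_top) h
    rwa [ENNReal.toReal_mul, ENNReal.toReal_ofReal (Real.exp_nonneg _)] at this
  obtain ⟨C, ρ, h0, h1, h2, h⟩ := exists_geometric_bound hr (a := fun n => (a n).toReal)
    (fun _ => ENNReal.toReal_nonneg) (fun n => key _ _ _ (har n)) (fun n => key _ _ _ (hab n)) hb hδ hf
  exact ⟨C, ρ, h0, h1, h2, fun n => ENNReal.le_ofReal_iff_toReal_le (hfin n) (by positivity) |>.2 (h n)⟩

/-- Half of the exponential rate of `ρ ^ n` absorbs the growth of `exp (b n)`; the other half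
remains, with `κ = √ρ`. -/
theorem IsSublinear.exp_mul_geometric {b : ℕ → ℝ} (hb : IsSublinear b) {ρ : ℝ} (h0 : 0 < ρ)
    (h1 : ρ < 1) :
    ∃ C κ : ℝ, 0 ≤ C ∧ 0 < κ ∧ κ < 1 ∧ ∀ n, Real.exp (b n) * ρ ^ n ≤ C * κ ^ n := by
  have hl : Real.log ρ < 0 := Real.log_neg h0 h1
  obtain ⟨B, hB⟩ := hb (-Real.log ρ / 2) (by linarith)
  refine ⟨Real.exp B, Real.exp (Real.log ρ / 2), (Real.exp_pos _).le, Real.exp_pos _,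
    Real.exp_lt_one_iff.2 (by linarith), fun n => ?_⟩
  rw [← Real.exp_log (pow_pos h0 n), Real.log_pow, ← Real.exp_nat_mul, ← Real.exp_add,
    ← Real.exp_add]
  exact Real.exp_le_exp.2 (by linarith [hB n])

theorem sum_geometric_le {κ : ℝ} (h0 : 0 ≤ κ) (h1 : κ < 1) (n : ℕ) :
    ∑ k ∈ Finset.range n, κ ^ k ≤ (1 - κ)⁻¹ := by
  rw [← tsum_geometric_of_lt_one h0 h1]
  exact (summable_geometric_of_lt_one h0 h1).sum_le_tsum _ fun _ _ => by positivity

/-! ### Lipschitz coefficients -/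

/-- The recursion defining `pastIterate` splits off the newest map; backward iteration needs the
oldest one, applied first. -/
theorem pastIterate_succ' {E : Type*} (φ : ℤ → E → E) (t : ℤ) (n : ℕ) :
    pastIterate φ t (n + 1) = pastIterate φ t n ∘ φ (t - n) := by
  induction n generalizing t with
  | zero => simp [pastIterate]
  | succ n ih =>
    rw [pastIterate, ih, pastIterate, Function.comp_assoc]
    push_cast
    ring_nf

theorem pastIterate_add {E : Type*} (φ : ℤ → E → E) (t : ℤ) (m n : ℕ) :
    pastIterate φ t (m + n) = pastIterate φ t m ∘ pastIterate φ (t - m) n := by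
  induction m generalizing t with
  | zero => simp [pastIterate]
  | succ m ih =>
    rw [Nat.add_right_comm, pastIterate, ih, pastIterate, Function.comp_assoc]
    push_cast
    ring_nf

section Lip

variable {E : Type*} [MetricSpace E]

theorem edist_le_lipCoeff_mul (φ : E → E) (x y : E) :
    edist (φ x) (φ y) ≤ lipCoeff φ * edist x y := by
  rcases eq_or_ne x y with rfl | h
  · simp
  · rw [← ENNReal.div_le_iff (by simpa using h) (edist_ne_top x y)]
    exact le_iSup₂_of_le x y (le_iSup (fun _ : x ≠ y => _) h)

theorem lipCoeff_le {φ : E → E} {L : ℝ≥0∞} (h : ∀ x y, edist (φ x) (φ y) ≤ L * edist x y) :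
    lipCoeff φ ≤ L :=
  iSup_le fun x => iSup_le fun y => iSup_le fun _ => ENNReal.div_le_of_le_mul (h x y)

theorem lipCoeff_id_le : lipCoeff (id : E → E) ≤ 1 := lipCoeff_le fun x y => by simp

theorem lipCoeff_comp_le (φ ψ : E → E) : lipCoeff (φ ∘ ψ) ≤ lipCoeff φ * lipCoeff ψ :=
  lipCoeff_le fun x y => (edist_le_lipCoeff_mul φ _ _).trans <| by
    rw [mul_assoc]
    gcongr
    exact edist_le_lipCoeff_mul ψ x y

/-- A countable supremum is what makes the Lipschitz coefficient of a random map measurable. -/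
theorem lipCoeff_eq_iSup_denseSeq [SeparableSpace E] [Nonempty E] {φ : E → E} (hφ : Continuous φ) :
    lipCoeff φ = ⨆ (i : ℕ) (j : ℕ), edist (φ (denseSeq E i)) (φ (denseSeq E j)) /
      edist (denseSeq E i) (denseSeq E j) := by
  apply le_antisymm
  · set L := ⨆ (i : ℕ) (j : ℕ), edist (φ (denseSeq E i)) (φ (denseSeq E j)) /
      edist (denseSeq E i) (denseSeq E j) with hL
    rcases eq_or_ne L ∞ with h | h
    · rw [h]; exact le_top
    · refine lipCoeff_le fun x y => ?_
      refine (denseRange_denseSeq E).induction_on₂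
        (p := fun x y => edist (φ x) (φ y) ≤ L * edist x y) ?_ ?_ x y
      · exact isClosed_le (by fun_prop) ((ENNReal.continuous_const_mul h).comp (by fun_prop))
      · intro i j
        rcases eq_or_ne (denseSeq E i) (denseSeq E j) with hij | hij
        · simp [hij]
        · rw [← ENNReal.div_le_iff (by simpa using hij) (edist_ne_top _ _)]
          exact le_iSup₂_of_le (f := fun i j => edist (φ (denseSeq E i)) (φ (denseSeq E j)) /
            edist (denseSeq E i) (denseSeq E j)) i j le_rfl
  · exact iSup_le fun i => iSup_le fun j => ENNReal.div_le_of_le_mul (edist_le_lipCoeff_mul φ _ _)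

theorem measurable_lipCoeff {S : Type*} [MeasurableSpace S] [SecondCountableTopology E]
    [MeasurableSpace E] [OpensMeasurableSpace E] [Nonempty E] {ψ : S → E → E}
    (hc : ∀ v, Continuous (ψ v)) (hm : ∀ x, Measurable fun v => ψ v x) :
    Measurable fun v => lipCoeff (ψ v) := by
  simp_rw [fun v => lipCoeff_eq_iSup_denseSeq (hc v)]
  exact Measurable.iSup fun i => Measurable.iSup fun j => ((hm _).edist (hm _)).div_const _

theorem continuous_pastIterate {φ : ℤ → E → E} (hφ : ∀ t, Continuous (φ t)) (t : ℤ) (n : ℕ) :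
    Continuous (pastIterate φ t n) := by
  induction n generalizing t with
  | zero => exact continuous_id
  | succ n ih => exact (hφ t).comp (ih _)

theorem measurable_pastIterate {S : Type*} [MeasurableSpace S] [SecondCountableTopology E]
    [MeasurableSpace E] [BorelSpace E] {φ : ℤ → S → E → E}
    (hc : ∀ t v, Continuous (φ t v)) (hm : ∀ t x, Measurable fun v => φ t v x) (t : ℤ) (n : ℕ)
    (x : E) : Measurable fun v => pastIterate (fun s => φ s v) t n x := by
  induction n generalizing t with
  | zero => exact measurable_const
  | succ n ih =>
    have h := measurable_uncurry_of_continuous_of_measurable (u := fun x v => φ t v x) (hc t) (hm t)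
    exact h.comp ((ih (t - 1)).prodMk measurable_id)

end Lip

/-! ### Logarithmic moments -/

section LogMoments

variable {S : Type*} [MeasurableSpace S] {P : Measure S} {Y : S → ℝ≥0∞}

theorem le_ofReal_exp {y : ℝ≥0∞} {c : ℝ} (h : ENNReal.log y ≤ (c : EReal)) :
    y ≤ ENNReal.ofReal (Real.exp c) := by
  rw [← Real.log_exp c, ← ENNReal.log_ofReal_of_pos (Real.exp_pos c)] at h
  exact ENNReal.log_le_log_iff.1 h

theorem exists_integrable_log_bound (hY : Measurable Y) (h : meanLogPos P Y < ∞) :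
    ∃ b : S → ℝ, Measurable b ∧ Integrable b P ∧ (∀ x, 0 ≤ b x) ∧
      (∀ᵐ x ∂P, (b x : EReal) = (ENNReal.log (Y x)).toENNReal) ∧
      (∀ᵐ x ∂P, Y x ≤ ENNReal.ofReal (Real.exp (b x))) := by
  have hm : Measurable fun x => (ENNReal.log (Y x)).toENNReal :=
    measurable_ereal_toENNReal.comp (ENNReal.measurable_log.comp hY)
  have hfin := ae_lt_top hm h.ne
  have heq : ∀ᵐ x ∂P, ((ENNReal.log (Y x)).toENNReal.toReal : EReal)
      = (ENNReal.log (Y x)).toENNReal := by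
    filter_upwards [hfin] with x hx
    exact EReal.coe_ennreal_toReal hx.ne 
  refine ⟨fun x => (ENNReal.log (Y x)).toENNReal.toReal, hm.ennreal_toReal,
    integrable_toReal_of_lintegral_ne_top hm.aemeasurable h.ne, fun _ => ENNReal.toReal_nonneg,
    heq, ?_⟩
  filter_upwards [heq] with x hx
  refine le_ofReal_exp ?_
  rw [hx, EReal.coe_toENNReal_eq_max]
  exact le_max_right _ _

theorem exists_simpleFunc_lt_lintegral {g : S → ℝ≥0∞} {L : ℝ≥0∞} (h : L < ∫⁻ x, g x ∂P) :
    ∃ φ : SimpleFunc S ℝ≥0, (∀ x, (φ x : ℝ≥0∞) ≤ g x) ∧ L < ∫⁻ x, φ x ∂P := by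
  rw [lintegral_eq_nnreal] at h
  obtain ⟨φ, hφ⟩ := lt_iSup_iff.1 h
  obtain ⟨hle, hφ⟩ := lt_iSup_iff.1 hφ
  refine ⟨φ, hle, ?_⟩
  rwa [← SimpleFunc.lintegral_eq_lintegral] at hφ

theorem SimpleFunc.integrable_coe_nnreal [IsFiniteMeasure P] (φ : SimpleFunc S ℝ≥0) :
    Integrable (fun x => (φ x : ℝ)) P :=
  (φ.map ((↑) : ℝ≥0 → ℝ)).integrable_of_isFiniteMeasure

theorem SimpleFunc.lintegral_eq_ofReal_integral [IsFiniteMeasure P] (φ : SimpleFunc S ℝ≥0) :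
    ∫⁻ x, φ x ∂P = ENNReal.ofReal (∫ x, (φ x : ℝ) ∂P) := by
  rw [ofReal_integral_eq_lintegral_ofReal (SimpleFunc.integrable_coe_nnreal φ)
    (ae_of_all _ fun _ => NNReal.coe_nonneg _)]
  simp

/-- `log⁻ Y` may have infinite mean, so it is replaced by a simple function `φ ≤ log⁻ Y` whose mean
still exceeds that of `log⁺ Y`. Then `log⁺ Y - φ` is an integrable majorant of `log Y` with negative
mean. -/
theorem exists_integrable_neg_log_bound [IsProbabilityMeasure P] (hY : Measurable Y)
    (h : MeanLogNegative P Y) :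
    ∃ f : S → ℝ, Measurable f ∧ Integrable f P ∧ ∫ x, f x ∂P < 0 ∧
      ∀ᵐ x ∂P, Y x ≤ ENNReal.ofReal (Real.exp (f x)) := by
  obtain ⟨b, hbm, hbi, hb0, hbeq, -⟩ := exists_integrable_log_bound hY (h.trans_le le_top)
  obtain ⟨φ, hφ, hlt⟩ := exists_simpleFunc_lt_lintegral h
  have hφi := SimpleFunc.integrable_coe_nnreal (P := P) φ
  refine ⟨fun x => b x - φ x, hbm.sub φ.measurable.coe_nnreal_real, hbi.sub hφi, ?_, ?_⟩
  · rw [integral_sub hbi hφi, sub_neg]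
    have h1 : meanLogPos P Y = ENNReal.ofReal (∫ x, b x ∂P) := by
      rw [ofReal_integral_eq_lintegral_ofReal hbi (ae_of_all _ hb0)]
      refine lintegral_congr_ae ?_
      filter_upwards [hbeq] with x hx
      rw [← EReal.coe_ennreal_eq_coe_ennreal_iff, ← hx, EReal.coe_ennreal_ofReal,
        max_eq_left (hb0 x)]
    rw [h1, SimpleFunc.lintegral_eq_ofReal_integral] at hlt
    exact (ENNReal.ofReal_lt_ofReal_iff_of_nonneg (integral_nonneg hb0)).1 hlt
  · filter_upwards [hbeq] with x hx
    refine le_ofReal_exp ?_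
    rw [EReal.coe_sub, hx]
    rcases le_total 0 (ENNReal.log (Y x)) with h0 | h0
    · have h2 := hφ x
      rw [EReal.toENNReal_of_nonpos (by simpa using h0)] at h2
      have h3 : φ x = 0 := by simpa using h2
      rw [EReal.coe_toENNReal h0, h3]
      simp
    · have h2 := hφ x
      rw [EReal.toENNReal_of_nonpos h0, EReal.coe_ennreal_zero, zero_sub, EReal.le_neg]
      rw [← EReal.coe_ennreal_le_coe_ennreal_iff, EReal.coe_toENNReal (by simpa using h0)] at h2
      exact h2

end LogMoments

/-! ### Shifts of the path space -/

/-- The shift by `t` on two-sided sequences. -/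
def shiftBy {F : Type*} (t : ℤ) (v : ℤ → F) : ℤ → F := fun s => v (s + t)

section Shift

variable {F : Type*}

@[simp] theorem shiftBy_apply (t s : ℤ) (v : ℤ → F) : shiftBy t v s = v (s + t) := rfl

@[simp] theorem shiftBy_shiftBy (s t : ℤ) (v : ℤ → F) :
    shiftBy s (shiftBy t v) = shiftBy (s + t) v := by
  funext u; simp [add_assoc]

@[simp] theorem shiftBy_zero (v : ℤ → F) : shiftBy 0 v = v := by
  funext u; simp

theorem pastIterate_shift {E : Type*} (ψ : (ℤ → F) → E → E) (t u : ℤ) (n : ℕ) (v : ℤ → F) :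
    pastIterate (fun s => ψ (shiftBy s (shiftBy t v))) u n =
      pastIterate (fun s => ψ (shiftBy s v)) (u + t) n := by
  induction n generalizing u with
  | zero => rfl
  | succ n ih =>
    rw [pastIterate, pastIterate, ih, shiftBy_shiftBy]
    ring_nf

theorem iterate_seqShift (n : ℕ) (v : ℤ → F) : seqShift^[n] v = shiftBy n v := by
  induction n with
  | zero => simp
  | succ n ih =>
    rw [Function.iterate_succ_apply', ih]
    funext s
    simp [seqShift]
    ring_nf

variable [MeasurableSpace F] {P : Measure (ℤ → F)}

theorem measurable_shiftBy (t : ℤ) : Measurable (shiftBy t : (ℤ → F) → ℤ → F) :=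
  measurable_pi_lambda _ fun s => measurable_pi_apply (s + t)

/-- The shift as a measurable equivalence. -/
def seqShiftEquiv (F : Type*) [MeasurableSpace F] : (ℤ → F) ≃ᵐ (ℤ → F) where
  toFun := seqShift
  invFun := shiftBy (-1)
  left_inv v := by funext s; simp [seqShift]
  right_inv v := by funext s; simp [seqShift]
  measurable_toFun := measurable_shiftBy 1
  measurable_invFun := measurable_shiftBy (-1)

theorem seqShiftEquiv_symm_apply (v : ℤ → F) : (seqShiftEquiv F).symm v = shiftBy (-1) v := rfl

theorem iterate_seqShiftEquiv_symm (n : ℕ) (v : ℤ → F) :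
    (seqShiftEquiv F).symm^[n] v = shiftBy (-n) v := by
  induction n with
  | zero => simp
  | succ n ih =>
    rw [Function.iterate_succ_apply', ih]
    rw [seqShiftEquiv_symm_apply, shiftBy_shiftBy]
    push_cast
    ring_nf

/-- Backward iterates involve maps at ever earlier times, so the ergodic bounds are needed for the
inverse shift too. -/
theorem ergodic_seqShiftEquiv_symm (hP : Ergodic seqShift P) :
    Ergodic (seqShiftEquiv F).symm P :=
  Ergodic.symm (e := seqShiftEquiv F) hP

theorem measurePreserving_shiftBy (hP : MeasurePreserving seqShift P P) (t : ℤ) :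
    MeasurePreserving (shiftBy t) P P := by
  rcases Int.eq_nat_or_neg t with ⟨n, rfl | rfl⟩
  · convert hP.iterate n using 1
    funext v
    exact (iterate_seqShift n v).symm
  · have h : MeasurePreserving (seqShiftEquiv F).symm P P :=
      MeasurePreserving.symm (seqShiftEquiv F) hP
    convert h.iterate n using 1
    funext v
    exact (iterate_seqShiftEquiv_symm n v).symm

theorem ae_forall_shiftBy (hP : MeasurePreserving seqShift P P) {p : (ℤ → F) → Prop}
    (h : ∀ᵐ v ∂P, p v) : ∀ᵐ v ∂P, ∀ t, p (shiftBy t v) :=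
  ae_all_iff.2 fun t => (measurePreserving_shiftBy hP t).quasiMeasurePreserving.ae h

variable [IsProbabilityMeasure P] {f : (ℤ → F) → ℝ}

theorem ae_isSublinear_shiftBy (hP : Ergodic seqShift P) (hm : Measurable f)
    (hf : Integrable f P) : ∀ᵐ v ∂P, ∀ t : ℤ, IsSublinear fun n => f (shiftBy (n + t) v) := by
  filter_upwards [ae_forall_shiftBy hP.toMeasurePreserving (ae_isSublinear hP hm hf)] with v hv t
  simpa only [iterate_seqShift, shiftBy_shiftBy] using hv t

theorem ae_isSublinear_shiftBy_neg (hP : Ergodic seqShift P) (hm : Measurable f)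
    (hf : Integrable f P) : ∀ᵐ v ∂P, ∀ t : ℤ, IsSublinear fun n => f (shiftBy (-n + t) v) := by
  filter_upwards [ae_forall_shiftBy hP.toMeasurePreserving
    (ae_isSublinear (ergodic_seqShiftEquiv_symm hP) hm hf)] with v hv t
  simpa only [iterate_seqShiftEquiv_symm, shiftBy_shiftBy] using hv t

theorem ae_sum_shiftBy_le (hP : Ergodic seqShift P) (hm : Measurable f)
    (hf : Integrable f P) : ∀ᵐ v ∂P, ∀ t : ℤ, ∀ ε > 0, ∃ C : ℝ, ∀ n : ℕ,
      ∑ k ∈ Finset.range n, f (shiftBy (k + t) v) ≤ C + n * (∫ y, f y ∂P + ε) := by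
  filter_upwards [ae_forall_shiftBy hP.toMeasurePreserving (ae_birkhoffSum_le hP hm hf)] with v hv t
  simpa only [birkhoffSum, iterate_seqShift, shiftBy_shiftBy] using hv t

theorem ae_le_sum_shiftBy (hP : Ergodic seqShift P) (hm : Measurable f)
    (hf : Integrable f P) : ∀ᵐ v ∂P, ∀ t : ℤ, ∀ ε > 0, ∃ C : ℝ, ∀ n : ℕ,
      n * (∫ y, f y ∂P - ε) - C ≤ ∑ k ∈ Finset.range n, f (shiftBy (k + t) v) := by
  filter_upwards [ae_forall_shiftBy hP.toMeasurePreserving (ae_le_birkhoffSum hP hm hf)] with v hv t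
  simpa only [birkhoffSum, iterate_seqShift, shiftBy_shiftBy] using hv t

theorem ae_sum_shiftBy_neg_le (hP : Ergodic seqShift P) (hm : Measurable f)
    (hf : Integrable f P) : ∀ᵐ v ∂P, ∀ t : ℤ, ∀ ε > 0, ∃ C : ℝ, ∀ n : ℕ,
      ∑ k ∈ Finset.range n, f (shiftBy (-k + t) v) ≤ C + n * (∫ y, f y ∂P + ε) := by
  filter_upwards [ae_forall_shiftBy hP.toMeasurePreserving
    (ae_birkhoffSum_le (ergodic_seqShiftEquiv_symm hP) hm hf)] with v hv t
  simpa only [birkhoffSum, iterate_seqShiftEquiv_symm, shiftBy_shiftBy] using hv t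

end Shift

/-! ### Contractive stochastic recurrence equations driven by an ergodic sequence -/

/-- The limit of the backward iterates of a random map, started at `s`. -/
noncomputable def backwardLimit {F E : Type*} [MetricSpace E] (ψ : (ℤ → F) → E → E) (s : E) (v : ℤ → F) : E :=
  haveI : Nonempty E := ⟨s⟩
  limUnder atTop fun n => pastIterate (fun t => ψ (shiftBy t v)) (-1) n s

theorem backwardLimit_congr {F E : Type*} [MetricSpace E] {ψ : (ℤ → F) → E → E} {s : E} {v w : ℤ → F}
    (h : ∀ t < 0, ψ (shiftBy t v) = ψ (shiftBy t w)) : backwardLimit ψ s v = backwardLimit ψ s w := by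
  have key : ∀ (n : ℕ) (u : ℤ), u < 0 → pastIterate (fun t => ψ (shiftBy t v)) u n =
      pastIterate (fun t => ψ (shiftBy t w)) u n := by
    intro n
    induction n with
    | zero => exact fun _ _ => rfl
    | succ n ih =>
      intro u hu
      rw [pastIterate, pastIterate, ih _ (by omega), h u hu]
  simp_rw [backwardLimit, key _ (-1) (by norm_num)]

section Contraction

variable {F : Type*} [MeasurableSpace F] {P : Measure (ℤ → F)} [IsProbabilityMeasure P]
  {E : Type*} [MetricSpace E] [SecondCountableTopology E] [MeasurableSpace E] [BorelSpace E]
  [Nonempty E] {ψ : (ℤ → F) → E → E}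

theorem exists_lip_bounds (hP : Ergodic seqShift P) (hc : ∀ v, Continuous (ψ v))
    (hm : ∀ x, Measurable fun v => ψ v x) (hlip : meanLogPos P (fun v => lipCoeff (ψ v)) < ∞) {r : ℕ}
    (hcontr : MeanLogNegative P fun v => lipCoeff (pastIterate (fun t => ψ (shiftBy t v)) 0 r)) :
    ∃ b f : (ℤ → F) → ℝ, Measurable b ∧ Integrable b P ∧ Measurable f ∧ Integrable f P ∧
      ∫ v, f v ∂P < 0 ∧ ∀ᵐ v ∂P,
        (∀ t, lipCoeff (ψ (shiftBy t v)) ≤ ENNReal.ofReal (Real.exp (b (shiftBy t v)))) ∧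
        ∀ t, lipCoeff (pastIterate (fun s => ψ (shiftBy s v)) t r) ≤
          ENNReal.ofReal (Real.exp (f (shiftBy t v))) := by
  have hm1 : ∀ t x, Measurable fun v => ψ (shiftBy t v) x := fun t x =>
    (hm x).comp (measurable_shiftBy t)
  obtain ⟨b, hbm, hbi, -, -, hb⟩ := exists_integrable_log_bound (measurable_lipCoeff hc hm) hlip
  obtain ⟨f, hfm, hfi, hf0, hf⟩ := exists_integrable_neg_log_bound
    (measurable_lipCoeff (fun v => continuous_pastIterate (fun t => hc _) 0 r)
      (measurable_pastIterate (fun t v => hc _) hm1 0 r)) hcontr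
  refine ⟨b, f, hbm, hbi, hfm, hfi, hf0, ?_⟩
  filter_upwards [ae_forall_shiftBy hP.toMeasurePreserving hb,
    ae_forall_shiftBy hP.toMeasurePreserving hf] with v h1 h2
  refine ⟨h1, fun t => ?_⟩
  simpa only [pastIterate_shift, zero_add] using h2 t

/-- Forward in time the newest maps stand on the left: the block of length `r` split off ends at
time `n + r - 1`, which fixes the shift in `f`. -/
theorem ae_forward_contraction (hP : Ergodic seqShift P) (hc : ∀ v, Continuous (ψ v))
    (hm : ∀ x, Measurable fun v => ψ v x) (hlip : meanLogPos P (fun v => lipCoeff (ψ v)) < ∞) {r : ℕ}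
    (hr : 1 ≤ r)
    (hcontr : MeanLogNegative P fun v => lipCoeff (pastIterate (fun t => ψ (shiftBy t v)) 0 r)) :
    ∀ᵐ v ∂P, ∃ C ρ : ℝ, 0 ≤ C ∧ 0 < ρ ∧ ρ < 1 ∧ ∀ n : ℕ,
      lipCoeff (pastIterate (fun t => ψ (shiftBy t v)) (n - 1) n) ≤ ENNReal.ofReal (C * ρ ^ n) := by
  obtain ⟨b, f, hbm, hbi, hfm, hfi, hf0, h⟩ := exists_lip_bounds hP hc hm hlip hcontr
  filter_upwards [h, ae_isSublinear_shiftBy hP hbm hbi, ae_sum_shiftBy_le hP hfm hfi]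
    with v ⟨h1, h2⟩ h3 h4
  obtain ⟨D, hD⟩ := h4 (r - 1) (-(∫ v, f v ∂P) / 2) (by linarith)
  refine exists_geometric_bound_ennreal hr (f := fun n => f (shiftBy (n + (r - 1)) v))
    (b := fun n => b (shiftBy n v))
    (a := fun n => lipCoeff (pastIterate (fun t => ψ (shiftBy t v)) (n - 1) n))
    (ne_top_of_le_ne_top ENNReal.one_ne_top lipCoeff_id_le) ?_ ?_ (by simpa using h3 0)
    (δ := -(∫ v, f v ∂P) / 2) (D := D) (by linarith) (fun n => (hD n).trans (by linarith))
  · intro n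
    rw [add_comm n r, pastIterate_add, mul_comm]
    refine (lipCoeff_comp_le _ _).trans ?_
    gcongr
    · rw [show ((r + n : ℕ) : ℤ) - 1 = n + (r - 1) by push_cast; ring]
      exact h2 _
    · apply le_of_eq
      congr 2
      push_cast; ring
  · intro n
    rw [pastIterate, mul_comm]
    refine (lipCoeff_comp_le _ _).trans ?_
    gcongr
    · rw [show ((n + 1 : ℕ) : ℤ) - 1 = n by push_cast; ring]
      exact h1 _
    · apply le_of_eq
      congr 2
      push_cast; ring

/-- Here the final time `-1` is fixed and the block split off is the oldest one, on the right. -/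
theorem ae_backward_contraction (hP : Ergodic seqShift P) (hc : ∀ v, Continuous (ψ v))
    (hm : ∀ x, Measurable fun v => ψ v x) (hlip : meanLogPos P (fun v => lipCoeff (ψ v)) < ∞) {r : ℕ}
    (hr : 1 ≤ r)
    (hcontr : MeanLogNegative P fun v => lipCoeff (pastIterate (fun t => ψ (shiftBy t v)) 0 r)) :
    ∀ᵐ v ∂P, ∃ C ρ : ℝ, 0 ≤ C ∧ 0 < ρ ∧ ρ < 1 ∧ ∀ n : ℕ,
      lipCoeff (pastIterate (fun t => ψ (shiftBy t v)) (-1) n) ≤ ENNReal.ofReal (C * ρ ^ n) := by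
  obtain ⟨b, f, hbm, hbi, hfm, hfi, hf0, h⟩ := exists_lip_bounds hP hc hm hlip hcontr
  filter_upwards [h, ae_isSublinear_shiftBy_neg hP hbm hbi, ae_sum_shiftBy_neg_le hP hfm hfi]
    with v ⟨h1, h2⟩ h3 h4
  obtain ⟨D, hD⟩ := h4 (-1) (-(∫ v, f v ∂P) / 2) (by linarith)
  refine exists_geometric_bound_ennreal hr (f := fun n => f (shiftBy (-n + -1) v))
    (b := fun n => b (shiftBy (-n + -1) v))
    (a := fun n => lipCoeff (pastIterate (fun t => ψ (shiftBy t v)) (-1) n))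
    (ne_top_of_le_ne_top ENNReal.one_ne_top lipCoeff_id_le) ?_ ?_ (h3 (-1))
    (δ := -(∫ v, f v ∂P) / 2) (D := D) (by linarith) (fun n => (hD n).trans (by linarith))
  · intro n
    rw [pastIterate_add]
    refine (lipCoeff_comp_le _ _).trans ?_
    gcongr
    rw [show -1 - (n : ℤ) = -n + -1 by ring]
    exact h2 _
  · intro n
    rw [pastIterate_succ']
    refine (lipCoeff_comp_le _ _).trans ?_
    gcongr
    rw [show -1 - (n : ℤ) = -n + -1 by ring]
    exact h1 _

/-- Consecutive backward iterates apply the same contraction to `s` and to the image of `s` under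
one older map. The distance of these two points grows subexponentially by the logarithmic moment,
while the Lipschitz coefficient decays geometrically. -/
theorem ae_cauchySeq_pastIterate (hP : Ergodic seqShift P) (hc : ∀ v, Continuous (ψ v))
    (hm : ∀ x, Measurable fun v => ψ v x) (hlip : meanLogPos P (fun v => lipCoeff (ψ v)) < ∞) {r : ℕ}
    (hr : 1 ≤ r)
    (hcontr : MeanLogNegative P fun v => lipCoeff (pastIterate (fun t => ψ (shiftBy t v)) 0 r))
    {s s' : E} (hinit : meanLogPos P (fun v => edist (ψ v s) s') < ∞) :
    ∀ᵐ v ∂P, CauchySeq fun n => pastIterate (fun t => ψ (shiftBy t v)) (-1) n s := by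
  obtain ⟨c, hcm, hci, -, -, hcb⟩ := exists_integrable_log_bound ((hm s).edist measurable_const) hinit
  filter_upwards [ae_backward_contraction hP hc hm hlip hr hcontr,
    ae_forall_shiftBy hP.toMeasurePreserving hcb, ae_isSublinear_shiftBy_neg hP hcm hci]
    with v ⟨C, ρ, hC, h0, h1, h2⟩ h3 h4
  obtain ⟨B, κ, hB, hκ0, hκ1, hκ⟩ := (h4 (-1)).exp_mul_geometric h0 h1
  set κ' := max κ ρ with hκ'
  refine cauchySeq_of_le_geometric κ' (C * (B + dist s' s)) (max_lt hκ1 h1) fun n => ?_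
  have hd : dist (ψ (shiftBy (-n + -1) v) s) s ≤ Real.exp (c (shiftBy (-n + -1) v)) + dist s' s := by
    refine (dist_triangle _ s' _).trans (add_le_add ?_ le_rfl)
    have := h3 (-n + -1)
    rwa [edist_dist, ENNReal.ofReal_le_ofReal_iff (Real.exp_nonneg _)] at this
  have hL := (edist_le_lipCoeff_mul (pastIterate (fun t => ψ (shiftBy t v)) (-1) n) s
    (ψ (shiftBy (-n + -1) v) s)).trans (mul_le_mul_left (h2 n) _)
  rw [edist_dist, edist_dist, ← ENNReal.ofReal_mul (by positivity),
    ENNReal.ofReal_le_ofReal_iff (by positivity), dist_comm s] at hL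
  rw [pastIterate_succ', Function.comp_apply, show (-1 - (n : ℤ)) = -n + -1 by ring]
  calc _ ≤ _ := hL
    _ ≤ C * ρ ^ n * (Real.exp (c (shiftBy (-n + -1) v)) + dist s' s) := by gcongr
    _ = C * (Real.exp (c (shiftBy (-n + -1) v)) * ρ ^ n + dist s' s * ρ ^ n) := by ring
    _ ≤ C * (B * κ' ^ n + dist s' s * κ' ^ n) := by
      refine mul_le_mul_of_nonneg_left (add_le_add ((hκ n).trans ?_) ?_) hC
      · exact mul_le_mul_of_nonneg_left (pow_le_pow_left₀ hκ0.le (le_max_left _ _) n) hB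
      · exact mul_le_mul_of_nonneg_left (pow_le_pow_left₀ h0.le (le_max_right _ _) n) dist_nonneg
    _ = _ := by ring

theorem measurable_backwardLimit [CompleteSpace E] (hc : ∀ v, Continuous (ψ v))
    (hm : ∀ x, Measurable fun v => ψ v x) (s : E) : Measurable (backwardLimit ψ s) := by
  have hm1 : ∀ t x, Measurable fun v => ψ (shiftBy t v) x := fun t x =>
    (hm x).comp (measurable_shiftBy t)
  exact (StronglyMeasurable.limUnder fun n =>
    (measurable_pastIterate (fun t v => hc _) hm1 (-1) n s).stronglyMeasurable).measurable

/-- The iterate of length `n + 1` for time `t + 1` is the map at time `t` applied to the iterate of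
length `n` for time `t`; continuity passes this to the limit. -/
theorem ae_backwardLimit_succ [CompleteSpace E] (hP : Ergodic seqShift P)
    (hc : ∀ v, Continuous (ψ v))
    (hm : ∀ x, Measurable fun v => ψ v x) (hlip : meanLogPos P (fun v => lipCoeff (ψ v)) < ∞) {r : ℕ}
    (hr : 1 ≤ r)
    (hcontr : MeanLogNegative P fun v => lipCoeff (pastIterate (fun t => ψ (shiftBy t v)) 0 r))
    {s s' : E} (hinit : meanLogPos P (fun v => edist (ψ v s) s') < ∞) :
    ∀ᵐ v ∂P, ∀ t : ℤ, backwardLimit ψ s (shiftBy (t + 1) v) =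
      ψ (shiftBy t v) (backwardLimit ψ s (shiftBy t v)) := by
  filter_upwards [ae_forall_shiftBy hP.toMeasurePreserving
    (ae_cauchySeq_pastIterate hP hc hm hlip hr hcontr hinit)] with v hv t
  have h1 := CauchySeq.tendsto_limUnder (hv (t + 1))
  have h2 := ((hc (shiftBy t v)).tendsto _).comp (CauchySeq.tendsto_limUnder (hv t))
  rw [← tendsto_add_atTop_iff_nat 1] at h1
  refine tendsto_nhds_unique h1 (h2.congr fun n => ?_)
  simp only [Function.comp_apply, pastIterate_shift, pastIterate]
  rw [shiftBy_shiftBy]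
  ring_nf

/-- The solution is forgotten at a geometric rate. -/
theorem ae_dist_pastIterate_le (hP : Ergodic seqShift P) (hc : ∀ v, Continuous (ψ v))
    (hm : ∀ x, Measurable fun v => ψ v x) (hlip : meanLogPos P (fun v => lipCoeff (ψ v)) < ∞) {r : ℕ}
    (hr : 1 ≤ r)
    (hcontr : MeanLogNegative P fun v => lipCoeff (pastIterate (fun t => ψ (shiftBy t v)) 0 r)) :
    ∀ᵐ v ∂P, ∀ x y : ℕ → E, (∀ n : ℕ, x (n + 1) = ψ (shiftBy n v) (x n)) →
      (∀ n : ℕ, y (n + 1) = ψ (shiftBy n v) (y n)) →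
      ∃ C ρ : ℝ, 0 ≤ C ∧ 0 < ρ ∧ ρ < 1 ∧ ∀ n, dist (x n) (y n) ≤ C * ρ ^ n := by
  filter_upwards [ae_forward_contraction hP hc hm hlip hr hcontr] with v ⟨C, ρ, hC, h0, h1, h2⟩ x y
    hx hy
  have key : ∀ z : ℕ → E, (∀ n : ℕ, z (n + 1) = ψ (shiftBy n v) (z n)) →
      ∀ n : ℕ, z n = pastIterate (fun t => ψ (shiftBy t v)) (n - 1) n (z 0) := by
    intro z hz n
    induction n with
    | zero => rfl
    | succ n ih =>
      rw [hz, pastIterate, Function.comp_apply]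
      simp only [Nat.cast_add, Nat.cast_one, add_sub_cancel_right]
      rw [← ih]
  refine ⟨C * dist (x 0) (y 0), ρ, by positivity, h0, h1, fun n => ?_⟩
  have hL := (edist_le_lipCoeff_mul (pastIterate (fun t => ψ (shiftBy t v)) (n - 1) n) (x 0)
    (y 0)).trans (mul_le_mul_left (h2 n) _)
  rw [← key x hx, ← key y hy, edist_dist, edist_dist, ← ENNReal.ofReal_mul (by positivity),
    ENNReal.ofReal_le_ofReal_iff (by positivity)] at hL
  linarith

end Contraction

/-! ### Minimum contrast estimation with an ergodic contrast -/

section Contrast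

variable {F : Type*} [MeasurableSpace F] {P : Measure (ℤ → F)} [IsProbabilityMeasure P]
  {K : Type*} [MetricSpace K] {ℓ : (ℤ → F) → K → ℝ}

/-- Infima of the contrast over shrinking balls increase to its value at `θ`, so monotone
convergence gives a ball whose infimum has mean above `m`. The infimum runs over dense points for
measurability, and a simple function below it is integrable even if the mean at `θ` is infinite. -/
theorem exists_local_minorant [SeparableSpace K] (hc : ∀ v, Continuous (ℓ v))
    (hm : ∀ θ, Measurable fun v => ℓ v θ) (h0 : ∀ v θ, 0 ≤ ℓ v θ) {θ : K} {m : ℝ}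
    (hθ : ENNReal.ofReal m < ∫⁻ v, ENNReal.ofReal (ℓ v θ) ∂P) :
    ∃ V ∈ 𝓝 θ, ∃ f : (ℤ → F) → ℝ, Measurable f ∧ Integrable f P ∧ m < ∫ v, f v ∂P ∧
      ∀ v, ∀ θ' ∈ V, f v ≤ ℓ v θ' := by
  have : Nonempty K := ⟨θ⟩
  let B : ℕ → Set K := fun k => Metric.ball θ (1 / ((k : ℝ) + 1))
  let I : ℕ → (ℤ → F) → ℝ≥0∞ := fun k v =>
    ⨅ (i : ℕ) (_ : denseSeq K i ∈ B k), ENNReal.ofReal (ℓ v (denseSeq K i))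
  have hIm : ∀ k, Measurable (I k) := fun k => Measurable.iInf fun i => Measurable.iInf fun _ =>
    (hm _).ennreal_ofReal
  have hBmono : ∀ ⦃k l : ℕ⦄, k ≤ l → B l ⊆ B k := fun k l hkl =>
    Metric.ball_subset_ball (by gcongr)
  have hImono : Monotone I := fun k l hkl v =>
    le_iInf₂ fun i hi => iInf₂_le i (hBmono hkl hi)
  have hsup : ∀ v, ENNReal.ofReal (ℓ v θ) ≤ ⨆ k, I k v := by
    refine fun v => le_of_forall_lt fun a ha => ?_
    obtain ⟨a', haa', ha'⟩ := exists_between ha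
    have hcont : Continuous fun θ => ENNReal.ofReal (ℓ v θ) :=
      ENNReal.continuous_ofReal.comp (hc v)
    obtain ⟨ε, hε, hball⟩ := Metric.mem_nhds_iff.1 (hcont.continuousAt.eventually (lt_mem_nhds ha'))
    obtain ⟨k, hk⟩ := exists_nat_one_div_lt hε
    refine haa'.trans_le (le_iSup_of_le k (le_iInf₂ fun i hi => ?_))
    exact (hball (Metric.ball_subset_ball hk.le hi) : a' < _).le
  have hlt : ENNReal.ofReal m < ⨆ k, ∫⁻ v, I k v ∂P := by
    rw [← lintegral_iSup hIm hImono]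
    exact hθ.trans_le (lintegral_mono hsup)
  obtain ⟨k, hk⟩ := lt_iSup_iff.1 hlt
  obtain ⟨φ, hφ, hφlt⟩ := exists_simpleFunc_lt_lintegral hk
  refine ⟨B k, Metric.ball_mem_nhds _ (by positivity), fun v => φ v, φ.measurable.coe_nnreal_real,
    SimpleFunc.integrable_coe_nnreal φ, ?_, fun v θ' hθ' => ?_⟩
  · rw [SimpleFunc.lintegral_eq_ofReal_integral] at hφlt
    exact lt_of_not_ge fun h => not_le.2 hφlt (ENNReal.ofReal_le_ofReal h)
  · have hclosed : IsClosed {θ' | (φ v : ℝ) ≤ ℓ v θ'} := isClosed_le continuous_const (hc v)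
    have hsub : B k ∩ Set.range (denseSeq K) ⊆ {θ' | (φ v : ℝ) ≤ ℓ v θ'} := by
      rintro _ ⟨hi, i, rfl⟩
      have := (hφ v).trans (iInf₂_le i hi)
      rw [← ENNReal.ofReal_coe_nnreal, ENNReal.ofReal_le_ofReal_iff (h0 _ _)] at this
      exact this
    exact closure_minimal hsub hclosed
      ((denseRange_denseSeq K).open_subset_closure_inter Metric.isOpen_ball hθ')

/-- The compact complement of `U` is covered by finitely many neighbourhoods with integrable
minorants of mean above that at `θ₀`. Ergodic bounds for these finitely many functions give
uniformity in `θ`. -/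
theorem ae_sum_contrast_gap_of_nhds [CompactSpace K] (hP : Ergodic seqShift P)
    (hc : ∀ v, Continuous (ℓ v)) (hm : ∀ θ, Measurable fun v => ℓ v θ) (h0 : ∀ v θ, 0 ≤ ℓ v θ) {θ₀ : K}
    (hi : Integrable (fun v => ℓ v θ₀) P)
    (hlt : ∀ θ, θ ≠ θ₀ → ∫⁻ v, ENNReal.ofReal (ℓ v θ₀) ∂P < ∫⁻ v, ENNReal.ofReal (ℓ v θ) ∂P)
    {U : Set K} (hU : IsOpen U) (hθU : θ₀ ∈ U) :
    ∀ᵐ v ∂P, ∃ C δ : ℝ, 0 < δ ∧ ∀ n : ℕ, ∀ θ ∉ U,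
      ∑ t ∈ Finset.range n, ℓ (shiftBy (t + 1) v) θ₀ + δ * n - C ≤
        ∑ t ∈ Finset.range n, ℓ (shiftBy (t + 1) v) θ := by
  have key : ∀ θ, ∃ V ∈ 𝓝 θ, θ ∈ Uᶜ → ∃ f : (ℤ → F) → ℝ, Measurable f ∧ Integrable f P ∧
      ∫ v, ℓ v θ₀ ∂P < ∫ v, f v ∂P ∧ ∀ v, ∀ θ' ∈ V, f v ≤ ℓ v θ' := by
    intro θ
    by_cases hθ : θ ∈ Uᶜ
    · have hne : θ ≠ θ₀ := fun h => hθ (h ▸ hθU)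
      obtain ⟨V, hV, hf⟩ := exists_local_minorant hc hm h0 (θ := θ) (m := ∫ v, ℓ v θ₀ ∂P) (P := P) (by
        rw [ofReal_integral_eq_lintegral_ofReal hi (ae_of_all _ fun v => h0 v θ₀)]
        exact hlt θ hne)
      exact ⟨V, hV, fun _ => hf⟩
    · exact ⟨Set.univ, univ_mem, fun h => absurd h hθ⟩
  choose V hV hf using key
  obtain ⟨T, hTU, hT⟩ := hU.isClosed_compl.isCompact.elim_nhds_subcover V fun θ _ => hV θ
  have hlow : ∀ᵐ v ∂P, ∀ i : T, ∃ C δ : ℝ, 0 < δ ∧ ∀ n : ℕ, ∀ θ ∈ V i,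
      ∑ t ∈ Finset.range n, ℓ (shiftBy (t + 1) v) θ₀ + δ * n - C ≤
        ∑ t ∈ Finset.range n, ℓ (shiftBy (t + 1) v) θ := by
    refine ae_all_iff.2 fun i => ?_
    obtain ⟨f, hfm, hfi, hflt, hfle⟩ := hf i (hTU i i.2)
    filter_upwards [ae_sum_shiftBy_le hP (hm θ₀) hi, ae_le_sum_shiftBy hP hfm hfi] with v h1 h2
    -- One third of the gap is lost in each of the two ergodic bounds; the last third is the linear
    -- gain.
    set ε := (∫ v, f v ∂P - ∫ v, ℓ v θ₀ ∂P) / 3 with hε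
    obtain ⟨C, hC⟩ := h1 1 ε (by linarith)
    obtain ⟨C', hC'⟩ := h2 1 ε (by linarith)
    refine ⟨C + C', ε, by linarith, fun n θ hθ => ?_⟩
    have h3 : ∑ t ∈ Finset.range n, f (shiftBy (t + 1) v) ≤
        ∑ t ∈ Finset.range n, ℓ (shiftBy (t + 1) v) θ := Finset.sum_le_sum fun t _ => hfle _ θ hθ
    have h4 : (n : ℝ) * (∫ v, f v ∂P - ε) = n * (∫ v, ℓ v θ₀ ∂P + ε) + ε * n := by
      rw [hε]; ring
    linarith [hC n, hC' n]
  filter_upwards [hlow] with v hv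
  choose C δ hδ h using hv
  rcases T.eq_empty_or_nonempty with hT0 | hTne
  · refine ⟨0, 1, one_pos, fun n θ hθ => ?_⟩
    have := hT hθ
    simp [hT0] at this
  · have hne : (Finset.univ : Finset T).Nonempty := by
      obtain ⟨i, hi⟩ := hTne
      exact ⟨⟨i, hi⟩, Finset.mem_univ _⟩
    refine ⟨Finset.univ.sup' hne C, Finset.univ.inf' hne δ,
      (Finset.lt_inf'_iff _).2 fun i _ => hδ i, fun n θ hθ => ?_⟩
    obtain ⟨i, hiT, hi⟩ := Set.mem_iUnion₂.1 (hT hθ)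
    refine le_trans ?_ (h ⟨i, hiT⟩ n θ hi)
    gcongr
    · exact Finset.inf'_le _ (Finset.mem_univ _)
    · exact Finset.le_sup' _ (Finset.mem_univ _)

/-- Near-minimizers of a contrast that is approximated by an ergodic contrast converge to the
unique minimizer of the expected contrast. -/
theorem ae_forall_tendsto_of_contrast [CompactSpace K] (hP : Ergodic seqShift P)
    (hc : ∀ v, Continuous (ℓ v)) (hm : ∀ θ, Measurable fun v => ℓ v θ) (h0 : ∀ v θ, 0 ≤ ℓ v θ) {θ₀ : K}
    (hi : Integrable (fun v => ℓ v θ₀) P)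
    (hlt : ∀ θ, θ ≠ θ₀ → ∫⁻ v, ENNReal.ofReal (ℓ v θ₀) ∂P < ∫⁻ v, ENNReal.ofReal (ℓ v θ) ∂P) :
    ∀ᵐ v ∂P, ∀ θhat : ℕ → K, (∃ C : ℝ, ∀ n : ℕ, 1 ≤ n →
      ∑ t ∈ Finset.range n, ℓ (shiftBy (t + 1) v) (θhat n) ≤
        ∑ t ∈ Finset.range n, ℓ (shiftBy (t + 1) v) θ₀ + C) → Tendsto θhat atTop (𝓝 θ₀) := by
  have key := fun k : ℕ => ae_sum_contrast_gap_of_nhds hP hc hm h0 hi hlt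
    (Metric.isOpen_ball (x := θ₀) (ε := 1 / ((k : ℝ) + 1))) (Metric.mem_ball_self (by positivity))
  filter_upwards [ae_all_iff.2 key] with v hv θhat ⟨D, hD⟩
  refine Metric.tendsto_nhds.2 fun ε hε => ?_
  obtain ⟨k, hk⟩ := exists_nat_one_div_lt hε
  obtain ⟨C, δ, hδ, h⟩ := hv k
  have ht : Tendsto (fun n : ℕ => δ * (n : ℝ)) atTop atTop :=
    tendsto_natCast_atTop_atTop.const_mul_atTop hδ
  filter_upwards [ht.eventually_gt_atTop (C + D), eventually_ge_atTop 1] with n hn hn1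
  by_contra hcon
  have h1 := h n (θhat n) fun hmem => hcon ((Metric.mem_ball.1 hmem).trans hk)
  linarith [hD n hn1]

end Contrast

/-! ### The volatility recursion on the path space -/

/-- Evaluation at a dense sequence is a continuous injection of a Polish space into `ℕ → Y`, hence a
measurable embedding by Lusin–Souslin; so coordinates detect Borel measurability. -/
theorem measurable_continuousMap_of_eval {S K Y : Type*} [MeasurableSpace S] [MetricSpace K]
    [CompactSpace K] [MetricSpace Y] [CompleteSpace Y] [SecondCountableTopology Y]
    [MeasurableSpace Y] [BorelSpace Y] {f : S → C(K, Y)} (h : ∀ θ, Measurable fun v => f v θ) :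
    Measurable f := by
  have : BorelSpace C(K, Y) := ⟨rfl⟩
  rcases isEmpty_or_nonempty K with hK | hK
  · exact @measurable_of_subsingleton_codomain _ _ _ _
      ⟨fun a b => ContinuousMap.ext fun x => hK.elim x⟩ f
  · have hc : Continuous fun (s : C(K, Y)) (i : ℕ) => s (denseSeq K i) :=
      continuous_pi fun i => continuous_eval_const _
    have hinj : Function.Injective fun (s : C(K, Y)) (i : ℕ) => s (denseSeq K i) := by
      intro s s' hss
      refine DFunLike.coe_injective (Continuous.ext_on (denseRange_denseSeq K) s.continuous
        s'.continuous ?_)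
      rintro _ ⟨i, rfl⟩
      exact congrFun hss i
    exact (hc.measurableEmbedding hinj).measurable_comp_iff.1 (measurable_pi_lambda _ fun i => h _)

theorem dist_apply_le_dist_volState {q : ℕ} (s s' : VolState q) (i : Fin q) :
    dist (s i) (s' i) ≤ dist s s' := by
  have h := (PiLp.lipschitzWith_ofLp 2 fun _ : Fin q => ℝ≥0).dist_le_mul s s'
  rw [NNReal.coe_one, one_mul] at h
  exact (dist_le_pi_dist _ _ i).trans h

/-- The space of paths of the observations and squared volatilities. -/
abbrev PathSpace : Type := ℤ → ℝ × ℝ≥0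

/-- The observation process on the path space. -/
def obsProc (t : ℤ) (v : PathSpace) : ℝ := (v t).1

section Model

variable {d p q : ℕ} {Θ : Set (EuclideanSpace ℝ (Fin d))}
  {g : Θ → (Fin p → ℝ) → VolState q → ℝ≥0} {K : Compacts Θ}

theorem continuous_volMap (hg : ∀ x, Continuous fun a : K × VolState q => g a.1 x a.2)
    (x : Fin p → ℝ) : Continuous (volMap g K hg x) := by
  refine ContinuousMap.continuous_of_continuous_uncurry _ ?_
  have h : Continuous fun a : C(K, VolState q) × K => a.1 a.2 := continuous_eval
  exact continuous_pushState.comp (((hg x).comp (continuous_snd.prodMk h)).prodMk h)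

theorem measurable_volMap_apply (hmeas : ∀ (θ : K) (s : VolState q), Measurable fun x => g θ x s)
    (hg : ∀ x, Continuous fun a : K × VolState q => g a.1 x a.2) (s : C(K, VolState q)) :
    Measurable fun x => volMap g K hg x s :=
  measurable_continuousMap_of_eval fun θ =>
    continuous_pushState.measurable.comp ((hmeas θ (s θ)).prodMk measurable_const)

theorem measurable_obsVec {Ω : Type*} [MeasurableSpace Ω] {X : ℤ → Ω → ℝ}
    (hX : ∀ t, Measurable (X t)) (t : ℤ) : Measurable (obsVec p X t) :=
  measurable_pi_lambda _ fun _ => hX _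

theorem measurable_obsProc (t : ℤ) : Measurable (obsProc t) :=
  measurable_fst.comp (measurable_pi_apply t)

theorem obsVec_shiftBy (t u : ℤ) (v : PathSpace) :
    obsVec p obsProc u (shiftBy t v) = obsVec p obsProc (u + t) v := by
  funext i
  simp only [obsVec, obsProc, shiftBy_apply]
  ring_nf

variable (hg : ∀ x, Continuous fun a : K × VolState q => g a.1 x a.2) (ς : VolState q)

/-- The scalar volatility is a coordinate of the next state, so it inherits the contraction; for `q
= 0` the state space is a point and both sides vanish. -/
theorem dist_nextVol_le {Ω : Type*} (X : ℤ → Ω → ℝ) (t : ℤ) (ω : Ω) (s s' : C(K, VolState q))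
    (θ : K) : |(nextVol g K X t ω s θ : ℝ) - nextVol g K X t ω s' θ| ≤
      dist (sreMap g K hg X t ω s) (sreMap g K hg X t ω s') := by
  rcases Nat.eq_zero_or_pos q with rfl | hq
  · have : s = s' := ContinuousMap.ext fun θ => Subsingleton.elim _ _
    simp [this]
  · rw [nextVol_eq_first_coord g K hg X t ω s θ hq, nextVol_eq_first_coord g K hg X t ω s' θ hq]
    exact (dist_apply_le_dist_volState _ _ _).trans (ContinuousMap.dist_apply_le_dist θ)

/-- The random map of the volatility recursion on the path space. -/
noncomputable def pathMap (v : PathSpace) : C(K, VolState q) → C(K, VolState q) :=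
  sreMap g K hg obsProc 0 v

theorem pathMap_shiftBy (t : ℤ) (v : PathSpace) :
    pathMap hg (shiftBy t v) = sreMap g K hg obsProc t v := by
  simp only [pathMap, sreMap, obsVec_shiftBy, zero_add]

theorem continuous_pathMap (v : PathSpace) : Continuous (pathMap hg v) := continuous_volMap hg _

theorem measurable_pathMap (hmeas : ∀ (θ : K) (s : VolState q), Measurable fun x => g θ x s)
    (s : C(K, VolState q)) : Measurable fun v => pathMap hg v s :=
  (measurable_volMap_apply hmeas hg s).comp (measurable_obsVec measurable_obsProc 0)

/-- The stationary volatility functions `h_0` as a functional of the path. -/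
noncomputable def statVol (v : PathSpace) : C(K, VolState q) :=
  backwardLimit (pathMap hg) (ContinuousMap.const K ς) v

/-- The stationary squared volatility `h_0(θ)` as a functional of the path. -/
noncomputable def predVol (v : PathSpace) (θ : K) : ℝ≥0 :=
  nextVol g K obsProc (-1) v (statVol hg ς (shiftBy (-1) v)) θ

theorem measurable_statVol (hmeas : ∀ (θ : K) (s : VolState q), Measurable fun x => g θ x s) :
    Measurable (statVol hg ς) := by
  have : BorelSpace C(K, VolState q) := ⟨rfl⟩
  exact measurable_backwardLimit (continuous_pathMap hg) (measurable_pathMap hg hmeas) _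

theorem predVol_shiftBy (t : ℤ) (v : PathSpace) (θ : K) :
    predVol hg ς (shiftBy (t + 1) v) θ =
      nextVol g K obsProc t v (statVol hg ς (shiftBy t v)) θ := by
  simp only [predVol, nextVol, obsVec_shiftBy, shiftBy_shiftBy]
  ring_nf

theorem continuous_nextVol
    (hg : ∀ x, Continuous fun a : K × VolState q => g a.1 x a.2) {Ω : Type*} (X : ℤ → Ω → ℝ) (t : ℤ) (ω : Ω) (s : C(K, VolState q)) :
    Continuous (nextVol g K X t ω s) :=
  (hg _).comp (continuous_id.prodMk s.continuous)

theorem measurable_predVol (hmeas : ∀ (θ : K) (s : VolState q), Measurable fun x => g θ x s)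
    (θ : K) : Measurable fun v => predVol hg ς v θ := by
  have : BorelSpace C(K, VolState q) := ⟨rfl⟩
  have h1 : Measurable (Function.uncurry fun (s : VolState q) x => g θ x s) :=
    measurable_uncurry_of_continuous_of_measurable
      (fun x => (hg x).comp (continuous_const.prodMk continuous_id)) (hmeas θ)
  have h2 : Measurable fun s : C(K, VolState q) => s θ := (continuous_eval_const θ).measurable
  exact h1.comp ((h2.comp ((measurable_statVol hg ς hmeas).comp (measurable_shiftBy (-1)))).prodMk
    (measurable_obsVec measurable_obsProc (-1)))

/-- `h_0(θ)` depends on the past observations only. -/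
theorem predVol_congr {v w : PathSpace} (h : ∀ t < 0, (v t).1 = (w t).1) (θ : K) :
    predVol hg ς v θ = predVol hg ς w θ := by
  have hobs : ∀ t < 0, obsVec p obsProc t v = obsVec p obsProc t w := fun t ht =>
    funext fun i => h _ (by omega)
  have hstat : statVol hg ς (shiftBy (-1) v) = statVol hg ς (shiftBy (-1) w) := by
    refine backwardLimit_congr fun t ht => ?_
    rw [shiftBy_shiftBy, shiftBy_shiftBy, pathMap_shiftBy, pathMap_shiftBy]
    simp only [sreMap, hobs (t + -1) (by omega)]
  simp only [predVol, nextVol, hstat, hobs (-1) (by norm_num)]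

/-! ### The quasi likelihood contrast -/

theorem abs_div_add_log_sub_le {a c x y : ℝ} (ha : 0 ≤ a) (hc : 0 < c) (hx : c ≤ x) (hy : c ≤ y) :
    |(a / x + Real.log x) - (a / y + Real.log y)| ≤ (a / c ^ 2 + 1 / c) * |x - y| := by
  have hx0 := hc.trans_le hx
  have hy0 := hc.trans_le hy
  have h1 : |a / x - a / y| ≤ a / c ^ 2 * |x - y| := by
    have : a / x - a / y = a / (x * y) * (y - x) := by field_simp
    rw [this, abs_mul, abs_of_nonneg (by positivity), abs_sub_comm]
    gcongr
    nlinarith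
  have h2 : ∀ x y : ℝ, c ≤ x → c ≤ y → Real.log x - Real.log y ≤ 1 / c * |x - y| := by
    intro x y hx hy
    have hx0 := hc.trans_le hx
    have hy0 := hc.trans_le hy
    rw [← Real.log_div hx0.ne' hy0.ne']
    calc Real.log (x / y) ≤ x / y - 1 := Real.log_le_sub_one_of_pos (by positivity)
      _ = 1 / y * (x - y) := by field_simp
      _ ≤ 1 / y * |x - y| := by gcongr; exact le_abs_self _
      _ ≤ 1 / c * |x - y| := by gcongr
  have h3 : |Real.log x - Real.log y| ≤ 1 / c * |x - y| :=
    abs_le.2 ⟨by linarith [h2 y x hy hx, abs_sub_comm x y ▸ h2 y x hy hx], h2 x y hx hy⟩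
  calc _ = |(a / x - a / y) + (Real.log x - Real.log y)| := by ring_nf
    _ ≤ _ := (abs_add_le _ _).trans (by linarith)

/-- The stationary contrast `X_0² / h_0(θ) + log h_0(θ)`, normalised by a constant `log c`. -/
noncomputable def contrast (c : ℝ≥0) (v : PathSpace) (θ : K) : ℝ :=
  obsProc 0 v ^ 2 / (predVol hg ς v θ : ℝ) + Real.log (predVol hg ς v θ) - Real.log c

variable {c : ℝ≥0}

theorem continuous_contrast (hc : 0 < c) (hlow : ∀ (θ : K) x s, c ≤ g θ x s) (v : PathSpace) :
    Continuous (contrast hg ς c v) := by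
  have h : Continuous fun θ => (predVol hg ς v θ : ℝ) :=
    NNReal.continuous_coe.comp (continuous_nextVol hg _ _ _ _)
  have h0 : ∀ θ, (predVol hg ς v θ : ℝ) ≠ 0 := fun θ =>
    NNReal.coe_ne_zero.2 (hc.trans_le (hlow _ _ _)).ne'
  exact ((continuous_const.div h h0).add (h.log h0)).sub continuous_const

theorem measurable_contrast (hmeas : ∀ (θ : K) (s : VolState q), Measurable fun x => g θ x s)
    (θ : K) : Measurable fun v => contrast hg ς c v θ := by
  have h := (measurable_predVol hg ς hmeas θ).coe_nnreal_real
  exact ((((measurable_obsProc 0).pow_const 2).div h).add h.log).sub_const _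

theorem contrast_nonneg (hc : 0 < c) (hlow : ∀ (θ : K) x s, c ≤ g θ x s) (v : PathSpace) (θ : K) :
    0 ≤ contrast hg ς c v θ := by
  have h : Real.log c ≤ Real.log (predVol hg ς v θ) :=
    Real.log_le_log (by exact_mod_cast hc) (by exact_mod_cast hlow _ _ _)
  have : 0 ≤ obsProc 0 v ^ 2 / (predVol hg ς v θ : ℝ) := by positivity
  unfold contrast
  linarith

/-- Starting the recursion at a fixed value changes the quasi likelihood by a bounded amount. -/
theorem ae_abs_quasiLogLik_add_le {P : Measure PathSpace} [IsProbabilityMeasure P]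
    (hP : Ergodic seqShift P)
    (hmeas : ∀ (θ : K) (s : VolState q), Measurable fun x => g θ x s)
    (hlip : meanLogPos P (fun v => lipCoeff (pathMap hg v)) < ∞) {r : ℕ} (hr : 1 ≤ r)
    (hcontr : MeanLogNegative P fun v =>
      lipCoeff (pastIterate (fun t => pathMap hg (shiftBy t v)) 0 r))
    {s' : C(K, VolState q)}
    (hinit : meanLogPos P (fun v => edist (pathMap hg v (ContinuousMap.const K ς)) s') < ∞)
    (hobs : Integrable (fun v => Real.log (1 + obsProc 0 v ^ 2)) P)
    (hc : 0 < c) (hlow : ∀ (θ : K) x s, c ≤ g θ x s) :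
    ∀ᵐ v ∂P, ∃ C : ℝ, ∀ (n : ℕ) (θ : K),
      |2 * quasiLogLik g K hg obsProc ς n v θ +
        ∑ t ∈ Finset.range n, contrast hg ς c (shiftBy (t + 1) v) θ + n * Real.log c| ≤ C := by
  have : BorelSpace C(K, VolState q) := ⟨rfl⟩
  have : Nonempty C(K, VolState q) := ⟨s'⟩
  have hom : Measurable fun v => Real.log (1 + obsProc 0 v ^ 2) :=
    (((measurable_obsProc 0).pow_const 2).const_add 1).log
  have hpc := continuous_pathMap hg
  have hpm := measurable_pathMap hg hmeas
  have hc0 : (0 : ℝ) < c := by exact_mod_cast hc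
  filter_upwards [ae_dist_pastIterate_le hP hpc hpm hlip hr hcontr,
    ae_backwardLimit_succ hP hpc hpm hlip hr hcontr hinit, ae_isSublinear_shiftBy hP hom hobs]
    with v h1 h2 h3
  have hhat : ∀ n : ℕ, volHat g K hg obsProc ς (n + 1) v =
      pathMap hg (shiftBy n v) (volHat g K hg obsProc ς n v) := fun n => by
    rw [pathMap_shiftBy, volHat]
  have hstat : ∀ t : ℤ, statVol hg ς (shiftBy (t + 1) v) =
      pathMap hg (shiftBy t v) (statVol hg ς (shiftBy t v)) := h2
  obtain ⟨C, ρ, hC, hρ0, hρ1, hρ⟩ := h1 (fun n => volHat g K hg obsProc ς n v)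
    (fun n => statVol hg ς (shiftBy n v)) hhat (fun n => by push_cast; exact hstat n)
  -- The Lipschitz constant of the contrast in the volatility is of order `1 + X²`; its logarithm is
  -- sublinear along the path, so its product with the geometric error is summable.
  obtain ⟨B, κ, hB, hκ0, hκ1, hκ⟩ := (h3 1).exp_mul_geometric hρ0 hρ1
  set D : ℝ := 1 / (c : ℝ) ^ 2 + 1 / c with hD
  have hD0 : 0 < D := by positivity
  refine ⟨D * (C * B) * (1 - κ)⁻¹, fun n θ => ?_⟩
  have hterm : ∀ t : ℕ, |contrast hg ς c (shiftBy (t + 1) v) θ + Real.log c -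
      (obsProc ((t : ℤ) + 1) v ^ 2 /
        (nextVol g K obsProc t v (volHat g K hg obsProc ς t v) θ : ℝ) +
        Real.log (nextVol g K obsProc t v (volHat g K hg obsProc ς t v) θ : ℝ))| ≤
      D * (C * B) * κ ^ t := by
    intro t
    have e1 : obsProc 0 (shiftBy ((t : ℤ) + 1) v) = obsProc ((t : ℤ) + 1) v := by
      simp [obsProc]
    have e2 := h3 1
    rw [contrast, sub_add_cancel, predVol_shiftBy, e1]
    refine (abs_div_add_log_sub_le (sq_nonneg _) hc0 (by exact_mod_cast hlow _ _ _)
      (by exact_mod_cast hlow _ _ _)).trans ?_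
    set x := obsProc ((t : ℤ) + 1) v
    have h4 : x ^ 2 / (c : ℝ) ^ 2 + 1 / c ≤ D * (1 + x ^ 2) := by
      have : D * (1 + x ^ 2) = x ^ 2 / (c : ℝ) ^ 2 + 1 / c + (1 / (c : ℝ) ^ 2 + x ^ 2 / c) := by
        rw [hD]; ring
      rw [this]
      have : 0 ≤ 1 / (c : ℝ) ^ 2 + x ^ 2 / c := by positivity
      linarith
    have h5 : |(nextVol g K obsProc t v (statVol hg ς (shiftBy t v)) θ : ℝ) -
        nextVol g K obsProc t v (volHat g K hg obsProc ς t v) θ| ≤ C * ρ ^ t := by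
      rw [abs_sub_comm]
      refine (dist_nextVol_le hg obsProc t v _ _ θ).trans ?_
      -- The images under the map at time `t` are the two trajectories at time `t + 1`.
      rw [← pathMap_shiftBy, ← hhat, ← hstat]
      have := hρ (t + 1)
      push_cast at this
      refine this.trans ?_
      gcongr C * ?_
      exact pow_le_pow_of_le_one hρ0.le hρ1.le (Nat.le_succ t)
    have h6 := hκ t
    simp only [e1] at h6
    rw [Real.exp_log (by positivity)] at h6
    calc _ ≤ D * (1 + x ^ 2) * (C * ρ ^ t) := by gcongr
      _ = D * C * ((1 + x ^ 2) * ρ ^ t) := by ring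
      _ ≤ D * C * (B * κ ^ t) := by gcongr
      _ = _ := by ring
  calc _ = |∑ t ∈ Finset.range n, (contrast hg ς c (shiftBy (t + 1) v) θ + Real.log c -
      (obsProc ((t : ℤ) + 1) v ^ 2 /
        (nextVol g K obsProc t v (volHat g K hg obsProc ς t v) θ : ℝ) +
        Real.log (nextVol g K obsProc t v (volHat g K hg obsProc ς t v) θ : ℝ)))| := by
        rw [Finset.sum_sub_distrib, Finset.sum_add_distrib, quasiLogLik]
        simp only [Finset.sum_const, Finset.card_range, nsmul_eq_mul]
        ring_nf
    _ ≤ ∑ t ∈ Finset.range n, D * (C * B) * κ ^ t :=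
      (Finset.abs_sum_le_sum_abs _ _).trans (Finset.sum_le_sum fun t _ => hterm t)
    _ ≤ _ := by
      rw [← Finset.mul_sum]
      gcongr
      exact sum_geometric_le hκ0.le hκ1 n

end Model

/-! ### Transfer between the probability space and the path space -/

section Transfer

variable {Ω S : Type*} [MeasurableSpace Ω] [MeasurableSpace S] {μ : Measure Ω} {f : Ω → S}
  {Y : S → ℝ≥0∞}

theorem meanLogPos_map (hf : Measurable f) (hY : Measurable Y) :
    meanLogPos (μ.map f) Y = meanLogPos μ fun ω => Y (f ω) :=
  lintegral_map (measurable_ereal_toENNReal.comp (ENNReal.measurable_log.comp hY)) hf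

theorem meanLogNeg_map (hf : Measurable f) (hY : Measurable Y) :
    meanLogNeg (μ.map f) Y = meanLogNeg μ fun ω => Y (f ω) :=
  lintegral_map (measurable_ereal_toENNReal.comp (ENNReal.measurable_log.comp hY).neg) hf

theorem meanLogNegative_map (hf : Measurable f) (hY : Measurable Y) :
    MeanLogNegative (μ.map f) Y ↔ MeanLogNegative μ fun ω => Y (f ω) := by
  rw [MeanLogNegative, MeanLogNegative, meanLogPos_map hf hY, meanLogNeg_map hf hY]

theorem measurable_seqPath {E : Type*} [MeasurableSpace E] {v : ℤ → Ω → E}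
    (hv : ∀ t, Measurable (v t)) : Measurable fun ω t => v t ω :=
  measurable_pi_lambda _ hv

/-- Functionals of the shifted paths of a stationary sequence form a stationary sequence. -/
theorem isStationarySeq_comp_shiftBy {E E' : Type*} [MeasurableSpace E] [MeasurableSpace E']
    {v : ℤ → Ω → E} (hv : ∀ t, Measurable (v t))
    (hP : MeasurePreserving seqShift (seqLaw μ v) (seqLaw μ v)) {H : (ℤ → E) → E'}
    (hH : Measurable H) : IsStationarySeq μ fun t ω => H (shiftBy t fun s => v s ω) := by
  have hpath := measurable_seqPath hv
  have hG : Measurable fun (w : ℤ → E) (t : ℤ) => H (shiftBy t w) :=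
    measurable_pi_lambda _ fun t => hH.comp (measurable_shiftBy t)
  refine ⟨fun t => hH.comp ((measurable_shiftBy t).comp hpath), measurable_shiftBy 1, ?_⟩
  have hlaw : seqLaw μ (fun t ω => H (shiftBy t fun s => v s ω)) =
      (seqLaw μ v).map fun (w : ℤ → E) (t : ℤ) => H (shiftBy t w) :=
    (Measure.map_map hG hpath).symm
  have hs : Measurable (seqShift : (ℤ → E') → ℤ → E') := measurable_shiftBy 1
  rw [hlaw, Measure.map_map hs hG]
  conv_rhs => rw [← hP.map_eq, Measure.map_map hG hP.measurable]
  congr 1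
  funext w t
  change H (shiftBy (t + 1) w) = H (shiftBy t (shiftBy 1 w))
  rw [shiftBy_shiftBy]

end Transfer

/-! ### Independence of the noise of the past -/

theorem pastField_mono {Ω : Type*} {Z : ℤ → Ω → ℝ} {s t : ℤ} (h : s ≤ t) : pastField Z s ≤ pastField Z t :=
  iSup₂_le fun k hk => le_iSup₂_of_le k (hk.trans h) le_rfl

theorem measurable_pastField {Ω : Type*} {Z : ℤ → Ω → ℝ} (t : ℤ) : Measurable[pastField Z t] (Z t) :=
  Measurable.of_comap_le (le_iSup₂_of_le t le_rfl le_rfl)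

section Noise

variable {Ω : Type*} [mΩ : MeasurableSpace Ω] {μ : Measure Ω} {Z : ℤ → Ω → ℝ}

theorem pastField_le (hZ : ∀ t, Measurable (Z t)) (t : ℤ) : pastField Z t ≤ mΩ :=
  iSup₂_le fun k _ => (hZ k).comap_le

theorem indep_pastField (hZ : IsIIDNoise μ Z) :
    Indep (pastField Z (-1)) (MeasurableSpace.comap (Z 0) inferInstance) μ := by
  have h := indep_iSup_of_disjoint (fun k => (hZ.measurable k).comap_le) hZ.indep
    (S := {k | k ≤ -1}) (T := {0}) (by simp)
  simpa using h

theorem lintegral_noise_sq (hZ : IsIIDNoise μ Z) :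
    ∫⁻ ω, ENNReal.ofReal (Z 0 ω ^ 2) ∂μ = 1 := by
  have hi : Integrable (fun ω => Z 0 ω ^ 2) μ :=
    -- A non-integrable function has Bochner integral 0, so the value 1 forces integrability.
    Integrable.of_integral_ne_zero (by rw [hZ.second_moment]; exact one_ne_zero)
  rw [← ofReal_integral_eq_lintegral_ofReal hi (ae_of_all _ fun ω => sq_nonneg _),
    hZ.second_moment, ENNReal.ofReal_one]

end Noise

/-! ### The expected contrast -/

section Expectation

variable {Ω : Type*} [MeasurableSpace Ω] {μ : Measure Ω}
  {d p q : ℕ} {Θ : Set (EuclideanSpace ℝ (Fin d))}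
  {g : Θ → (Fin p → ℝ) → VolState q → ℝ≥0} {K : Compacts Θ}
  {Z : ℤ → Ω → ℝ} {X : ℤ → Ω → ℝ} {σ : ℤ → Ω → ℝ≥0}

/-- The path of the observations and squared volatilities. -/
def obsPath (X : ℤ → Ω → ℝ) (σ : ℤ → Ω → ℝ≥0) (ω : Ω) : PathSpace := fun t => (X t ω, σ t ω ^ 2)

theorem measurable_obsPath (hZ : IsIIDNoise μ Z) {γ : (Fin p → ℝ) → VolState q → ℝ≥0}
    (hsol : IsModelSolution μ Z γ X σ) : Measurable (obsPath X σ) :=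
  measurable_pi_lambda _ fun t => (hsol.measurable_obs t).prodMk
    (((hsol.measurable_vol t).mono (pastField_le hZ.measurable _) le_rfl).pow_const 2)

/-- `X_t` equals `σ_t Z_t` only almost surely and need not be adapted itself. The functional is
therefore evaluated on the adapted path built from `σ_t Z_t` for `t < 0`, the only times on which it
depends. -/
theorem exists_predVol_ae_eq {γ : (Fin p → ℝ) → VolState q → ℝ≥0}
    (hsol : IsModelSolution μ Z γ X σ)
    (hmeas : ∀ (θ : K) (s : VolState q), Measurable fun x => g θ x s)
    (hg : ∀ x, Continuous fun a : K × VolState q => g a.1 x a.2) (ς : VolState q) (θ : K) :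
    ∃ h : Ω → ℝ≥0, Measurable[pastField Z (-1)] h ∧
      ∀ᵐ ω ∂μ, predVol hg ς (obsPath X σ ω) θ = h ω := by
  let w : Ω → PathSpace := fun ω t => if t < 0 then (σ t ω * Z t ω, 0) else (0, 0)
  have hw : Measurable[pastField Z (-1)] w := by
    refine @measurable_pi_lambda _ _ _ (pastField Z (-1)) _ _ fun t => ?_
    by_cases ht : t < 0
    · simp only [w, ht, if_true]
      have h1 : Measurable[pastField Z (-1)] (σ t) :=
        (hsol.measurable_vol t).mono (pastField_mono (by omega)) le_rfl
      have h2 : Measurable[pastField Z (-1)] (Z t) :=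
        (measurable_pastField t).mono (pastField_mono (by omega)) le_rfl
      exact (h1.coe_nnreal_real.mul h2).prodMk measurable_const
    · simp only [w, ht, if_false]
      exact measurable_const
  refine ⟨fun ω => predVol hg ς (w ω) θ, (measurable_predVol hg ς hmeas θ).comp hw, ?_⟩
  filter_upwards [ae_all_iff.2 hsol.obs_eq] with ω hω
  refine predVol_congr hg ς (fun t ht => ?_) θ
  simp [w, ht, obsPath, hω t]

/-- Independence of `Z_0` from the past replaces `X_0² = σ_0² Z_0²` by `σ_0²`; since the terms are
nonnegative, no integrability is required. -/
theorem lintegral_contrast (hZ : IsIIDNoise μ Z) {γ : (Fin p → ℝ) → VolState q → ℝ≥0}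
    (hsol : IsModelSolution μ Z γ X σ)
    (hmeas : ∀ (θ : K) (s : VolState q), Measurable fun x => g θ x s)
    (hg : ∀ x, Continuous fun a : K × VolState q => g a.1 x a.2) (ς : VolState q) {c : ℝ≥0}
    (hc : 0 < c) (hlow : ∀ (θ : K) x s, c ≤ g θ x s) (θ : K) :
    ∫⁻ v, ENNReal.ofReal (contrast hg ς c v θ) ∂(μ.map (obsPath X σ)) =
      ∫⁻ ω, ENNReal.ofReal ((σ 0 ω : ℝ) ^ 2 / predVol hg ς (obsPath X σ ω) θ +
        Real.log (predVol hg ς (obsPath X σ ω) θ) - Real.log c) ∂μ := by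
  rw [lintegral_map (measurable_contrast hg ς hmeas θ).ennreal_ofReal (measurable_obsPath hZ hsol)]
  obtain ⟨h, hm, hh⟩ := exists_predVol_ae_eq hsol hmeas hg ς θ
  have hle := pastField_le hZ.measurable (-1)
  have hσ : Measurable[pastField Z (-1)] (σ 0) := by simpa using hsol.measurable_vol 0
  let a : Ω → ℝ≥0∞ := fun ω => ENNReal.ofReal ((σ 0 ω : ℝ) ^ 2 / h ω)
  let b : Ω → ℝ≥0∞ := fun ω => ENNReal.ofReal (Real.log (h ω) - Real.log c)
  have ham : Measurable[pastField Z (-1)] a :=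
    ((hσ.coe_nnreal_real.pow_const 2).div hm.coe_nnreal_real).ennreal_ofReal
  have hbm : Measurable b :=
    ((hm.mono hle le_rfl).coe_nnreal_real.log.sub_const _).ennreal_ofReal
  let z : Ω → ℝ≥0∞ := fun ω => ENNReal.ofReal (Z 0 ω ^ 2)
  have hzm : Measurable[MeasurableSpace.comap (Z 0) inferInstance] z :=
    ((comap_measurable (Z 0)).pow_const 2).ennreal_ofReal
  have hge : ∀ᵐ ω ∂μ, c ≤ h ω := by
    filter_upwards [hh] with ω hω
    rw [← hω]
    exact hlow _ _ _
  have hlog : ∀ ω, c ≤ h ω → 0 ≤ Real.log (h ω) - Real.log c := fun ω hω =>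
    sub_nonneg.2 (Real.log_le_log (by exact_mod_cast hc) (by exact_mod_cast hω))
  have h1 : ∫⁻ ω, ENNReal.ofReal (contrast hg ς c (obsPath X σ ω) θ) ∂μ =
      ∫⁻ ω, (a ω * z ω + b ω) ∂μ := by
    refine lintegral_congr_ae ?_
    filter_upwards [hh, hge, hsol.obs_eq 0] with ω e1 e2 e3
    have e4 : obsProc 0 (obsPath X σ ω) = σ 0 ω * Z 0 ω := e3
    rw [contrast, e1, e4, ← ENNReal.ofReal_mul (by positivity),
      ← ENNReal.ofReal_add (by positivity) (hlog ω e2)]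
    ring_nf
  have h2 : ∫⁻ ω, ENNReal.ofReal ((σ 0 ω : ℝ) ^ 2 / predVol hg ς (obsPath X σ ω) θ +
      Real.log (predVol hg ς (obsPath X σ ω) θ) - Real.log c) ∂μ = ∫⁻ ω, (a ω + b ω) ∂μ := by
    refine lintegral_congr_ae ?_
    filter_upwards [hh, hge] with ω e1 e2
    rw [e1, ← ENNReal.ofReal_add (by positivity) (hlog ω e2), add_sub_assoc]
  rw [h1, h2, lintegral_add_right _ hbm, lintegral_add_right _ hbm,
    lintegral_mul_eq_lintegral_mul_lintegral_of_independent_measurableSpace hle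
      (hZ.measurable 0).comap_le (indep_pastField hZ) ham hzm, lintegral_noise_sq hZ, mul_one]

theorem lintegral_log_ne_top {Y : Ω → ℝ≥0} (h : meanLogPos μ (fun ω => (Y ω : ℝ≥0∞)) < ∞)
    (hpos : ∀ᵐ ω ∂μ, 0 < Y ω) : ∫⁻ ω, ENNReal.ofReal (Real.log (Y ω)) ∂μ ≠ ∞ := by
  refine ne_of_eq_of_ne (lintegral_congr_ae ?_) h.ne
  filter_upwards [hpos] with ω hω
  rw [← ENNReal.ofReal_coe_nnreal, ENNReal.log_ofReal_of_pos (by exact_mod_cast hω),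
    EReal.real_coe_toENNReal]

theorem log_lt_div_add_log {x y : ℝ} (hx : 0 < x) (hy : 0 < y) (hne : x ≠ y) :
    1 + Real.log y < y / x + Real.log x := by
  have h := Real.log_lt_sub_one_of_pos (div_pos hy hx) (fun h => hne ((div_eq_one_iff_eq hx.ne').1 h).symm)
  rw [Real.log_div hy.ne' hx.ne'] at h
  linarith

/-- The true parameter is the unique minimizer of the expected contrast. -/
theorem lintegral_contrast_lt [IsProbabilityMeasure μ] (hZ : IsIIDNoise μ Z) {θ₀ : K}
    (hsol : IsModelSolution μ Z (g θ₀) X σ)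
    (hlog : meanLogPos μ (fun ω => ((σ 0 ω ^ 2 : ℝ≥0) : ℝ≥0∞)) < ∞)
    (hmeas : ∀ (θ : K) (s : VolState q), Measurable fun x => g θ x s)
    (hg : ∀ x, Continuous fun a : K × VolState q => g a.1 x a.2) (ς : VolState q) {c : ℝ≥0}
    (hc : 0 < c) (hlow : ∀ (θ : K) x s, c ≤ g θ x s)
    (hident : ∀ θ : K, (∀ᵐ ω ∂μ, predVol hg ς (obsPath X σ ω) θ = σ 0 ω ^ 2) ↔ θ = θ₀) :
    ∫⁻ v, ENNReal.ofReal (contrast hg ς c v θ₀) ∂(μ.map (obsPath X σ)) ≠ ∞ ∧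
      ∀ θ, θ ≠ θ₀ → ∫⁻ v, ENNReal.ofReal (contrast hg ς c v θ₀) ∂(μ.map (obsPath X σ)) <
        ∫⁻ v, ENNReal.ofReal (contrast hg ς c v θ) ∂(μ.map (obsPath X σ)) := by
  have hge : ∀ᵐ ω ∂μ, c ≤ σ 0 ω ^ 2 := by
    filter_upwards [hsol.vol_eq 0] with ω hω
    rw [hω]
    exact hlow _ _ _
  have h0 : ∫⁻ v, ENNReal.ofReal (contrast hg ς c v θ₀) ∂(μ.map (obsPath X σ)) =
      ∫⁻ ω, ENNReal.ofReal (1 + Real.log ((σ 0 ω ^ 2 : ℝ≥0) : ℝ) - Real.log c) ∂μ := by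
    rw [lintegral_contrast hZ hsol hmeas hg ς hc hlow]
    refine lintegral_congr_ae ?_
    filter_upwards [hge, (hident θ₀).2 rfl] with ω h1 h2
    have h3 : (σ 0 ω : ℝ) ^ 2 ≠ 0 := by exact_mod_cast (hc.trans_le h1).ne'
    rw [h2, NNReal.coe_pow, div_self h3]
  have hfin : ∫⁻ ω, ENNReal.ofReal (1 + Real.log ((σ 0 ω ^ 2 : ℝ≥0) : ℝ) - Real.log c) ∂μ ≠ ∞ := by
    refine ne_top_of_le_ne_top (b := ∫⁻ ω, (ENNReal.ofReal (1 - Real.log c) +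
      ENNReal.ofReal (Real.log ((σ 0 ω ^ 2 : ℝ≥0) : ℝ))) ∂μ) ?_ (lintegral_mono fun ω => ?_)
    · rw [lintegral_add_left measurable_const]
      refine ENNReal.add_ne_top.2 ⟨by simp, lintegral_log_ne_top hlog ?_⟩
      filter_upwards [hge] with ω hω using hc.trans_le hω
    · refine le_trans (ENNReal.ofReal_le_ofReal ?_) ENNReal.ofReal_add_le
      linarith
  refine ⟨h0 ▸ hfin, fun θ hθ => ?_⟩
  rw [h0, lintegral_contrast hZ hsol hmeas hg ς hc hlow]
  have hpm := ((measurable_predVol hg ς hmeas θ).comp (measurable_obsPath hZ hsol)).coe_nnreal_real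
  have hσ : Measurable (σ 0) := (hsol.measurable_vol 0).mono (pastField_le hZ.measurable _) le_rfl
  have hc0 : (0 : ℝ) < c := by exact_mod_cast hc
  -- Only the integral at `θ₀` must be finite. The integrands compare pointwise by `log u ≤ u - 1`,
  -- strictly where `h_0(θ) ≠ σ_0²`, an event of positive probability by identifiability.
  refine lintegral_strict_mono_of_ae_le_of_frequently_ae_lt
    (((((hσ.coe_nnreal_real.pow_const 2).div hpm).add hpm.log).sub_const _).ennreal_ofReal.aemeasurable)
    hfin ?_ ?_
  · filter_upwards [hge] with ω hω
    have hy : (0 : ℝ) < ((σ 0 ω ^ 2 : ℝ≥0) : ℝ) := by exact_mod_cast hc.trans_le hω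
    have hx : (0 : ℝ) < predVol hg ς (obsPath X σ ω) θ := by exact_mod_cast hc.trans_le (hlow _ _ _)
    refine ENNReal.ofReal_le_ofReal ?_
    rw [← NNReal.coe_pow]
    rcases eq_or_ne (predVol hg ς (obsPath X σ ω) θ : ℝ) ((σ 0 ω ^ 2 : ℝ≥0) : ℝ) with h | h
    · rw [h, div_self hy.ne']
    · linarith [log_lt_div_add_log hx hy h]
  · have hfreq : ∃ᵐ ω ∂μ, predVol hg ς (obsPath X σ ω) θ ≠ σ 0 ω ^ 2 :=
      fun h => hθ ((hident θ).1 (by simpa using h))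
    refine (hfreq.and_eventually hge).mono fun ω ⟨hne, hω⟩ => ne_of_lt ?_
    have hy : (0 : ℝ) < ((σ 0 ω ^ 2 : ℝ≥0) : ℝ) := by exact_mod_cast hc.trans_le hω
    have hx : (0 : ℝ) < predVol hg ς (obsPath X σ ω) θ := by exact_mod_cast hc.trans_le (hlow _ _ _)
    have h := log_lt_div_add_log hx hy (by exact_mod_cast hne)
    have hl : Real.log c ≤ Real.log ((σ 0 ω ^ 2 : ℝ≥0) : ℝ) :=
      Real.log_le_log hc0 (by exact_mod_cast hω)
    rw [← NNReal.coe_pow]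
    exact (ENNReal.ofReal_lt_ofReal_iff (by linarith)).2 (by linarith)

/-- With `y = h_0(θ)`, one has `log (1 + X_0²) = log y + log ((1 + X_0²) / y) ≤ log y + X_0² / y + 1
/ c`. The finite contrast at `θ₀` thus supplies the logarithmic moment of `X_0`. -/
theorem integrable_log_obs_of_contrast {P : Measure PathSpace} [IsProbabilityMeasure P]
    (hg : ∀ x, Continuous fun a : K × VolState q => g a.1 x a.2) (ς : VolState q) {c : ℝ≥0}
    (hc : 0 < c) (hlow : ∀ (θ : K) x s, c ≤ g θ x s) {θ : K}
    (hi : Integrable (fun v => contrast hg ς c v θ) P) :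
    Integrable (fun v => Real.log (1 + obsProc 0 v ^ 2)) P := by
  refine (hi.add (integrable_const (Real.log c + 1 / c))).mono'
    (((measurable_obsProc 0).pow_const 2).const_add 1).log.aestronglyMeasurable
    (ae_of_all _ fun v => ?_)
  set x := obsProc 0 v ^ 2 with hx
  have hx0 : 0 ≤ x := sq_nonneg _
  have hc0 : (0 : ℝ) < c := by exact_mod_cast hc
  have hle : (c : ℝ) ≤ predVol hg ς v θ := by exact_mod_cast hlow _ _ _
  set y : ℝ := (predVol hg ς v θ : ℝ) with hy
  have hy0 : 0 < y := hc0.trans_le hle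
  have h1 : Real.log (1 + x) = Real.log y + Real.log (1 / y + x / y) := by
    rw [← Real.log_mul hy0.ne' (by positivity)]
    congr 1
    field_simp
  have h2 : Real.log (1 / y + x / y) ≤ 1 / y + x / y :=
    (Real.log_le_sub_one_of_pos (by positivity)).trans (by linarith)
  have h3 : 1 / y ≤ 1 / (c : ℝ) := one_div_le_one_div_of_le hc0 hle
  rw [Real.norm_of_nonneg (Real.log_nonneg (by linarith))]
  simp only [Pi.add_apply, contrast, ← hx, ← hy]
  linarith

theorem volHat_obsPath {Ω : Type*} {X : ℤ → Ω → ℝ} {σ : ℤ → Ω → ℝ≥0}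
    (hg : ∀ x, Continuous fun a : K × VolState q => g a.1 x a.2) (ς : VolState q)
    (n : ℕ) (ω : Ω) :
    volHat g K hg obsProc ς n (obsPath X σ ω) = volHat g K hg X ς n ω := by
  induction n with
  | zero => rfl
  | succ n ih => rw [volHat, volHat, ih]; rfl

theorem quasiLogLik_obsPath {Ω : Type*} {X : ℤ → Ω → ℝ} {σ : ℤ → Ω → ℝ≥0}
    (hg : ∀ x, Continuous fun a : K × VolState q => g a.1 x a.2)
    (ς : VolState q) (n : ℕ) (ω : Ω) (θ : K) :
    quasiLogLik g K hg obsProc ς n (obsPath X σ ω) θ = quasiLogLik g K hg X ς n ω θ := by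
  simp only [quasiLogLik, volHat_obsPath]
  rfl

end Expectation

/-- Strong consistency of the Gaussian quasi maximum likelihood estimator in the model
`X_t = σ_t Z_t`, `σ_t² = g_θ(X_{t-1}, …, X_{t-p}; σ_{t-1}², …, σ_{t-q}²)`. -/
theorem theorem4p1 {Ω : Type*} [MeasurableSpace Ω] (μ : Measure Ω) [IsProbabilityMeasure μ]
    {d p q : ℕ} (Θ : Set (EuclideanSpace ℝ (Fin d)))
    (g : Θ → (Fin p → ℝ) → VolState q → ℝ≥0)
    (K : Compacts Θ) (θ₀ : Θ) (hθ₀ : θ₀ ∈ K)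
    (hmeas : ∀ (θ : K) (s : VolState q), Measurable fun x => g θ x s)
    (Z : ℤ → Ω → ℝ) (hZ : IsIIDNoise μ Z)
    (X : ℤ → Ω → ℝ) (σ : ℤ → Ω → ℝ≥0)
    -- the model at `θ₀` has a unique stationary ergodic solution, and `E[log⁺ σ_0²] < ∞`
    (hsol : IsUniqueStationaryErgodicSolution μ Z (g θ₀) X σ)
    (hlog : meanLogPos μ (fun ω => ((σ 0 ω ^ 2 : ℝ≥0) : ℝ≥0∞)) < ∞)
    -- `(θ, s) ↦ g_θ(x, s)` is continuous on `K × [0, ∞)^q` for every `x`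
    (hcont : ∀ x, Continuous fun a : K × VolState q => g a.1 x a.2)
    -- `ς` is the initial value, and `E[log⁺ ‖Φ_0(ς)‖_K] < ∞`
    (ς : VolState q)
    (hinit : meanLogPos μ (fun ω => edist (sreMap g K hcont X 0 ω (ContinuousMap.const K ς))
      (ContinuousMap.const K (WithLp.toLp 2 0))) < ∞)
    -- `E[log⁺ Λ(Φ_0)] < ∞` and `E[log Λ(Φ_0^{(r)})] < 0` for some `r ≥ 1`
    (hlip : meanLogPos μ (fun ω => lipCoeff (sreMap g K hcont X 0 ω)) < ∞)
    (hcontr : ∃ r : ℕ, 1 ≤ r ∧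
      MeanLogNegative μ fun ω => lipCoeff (pastIterate (fun t => sreMap g K hcont X t ω) 0 r))
    -- `g` is uniformly bounded from below
    (hlow : ∃ c : ℝ≥0, 0 < c ∧ ∀ (θ : K) x s, c ≤ g θ x s)
    -- for the stationary solution `h` of the recurrence equation and `θ ∈ K`:
    -- `h_0(θ) = σ_0²` almost surely if and only if `θ = θ₀`
    (hident : ∀ h : ℤ → Ω → C(K, VolState q), IsStationarySRESolution μ g K hcont X h →
      ∀ θ : K, (∀ᵐ ω ∂μ, nextVol g K X (-1) ω (h (-1) ω) θ = σ 0 ω ^ 2) ↔ (θ : Θ) = θ₀)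
    (θhat : ℕ → Ω → K) (hθhat : IsQMLE μ g K hcont X ς θhat) :
    ∀ᵐ ω ∂μ, Tendsto (fun n => (θhat n ω : Θ)) atTop (𝓝 θ₀) := by
  obtain ⟨⟨hmod, hXm, hP⟩, -⟩ := hsol
  obtain ⟨c, hc, hlow⟩ := hlow
  obtain ⟨r, hr, hcontr⟩ := hcontr
  have : BorelSpace C(K, VolState q) := ⟨rfl⟩
  have : Nonempty C(K, VolState q) := ⟨ContinuousMap.const K ς⟩
  have hpath : Measurable (obsPath X σ) := measurable_obsPath hZ hmod
  set P : Measure PathSpace := μ.map (obsPath X σ) with hPdef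
  have hP : Ergodic seqShift P := hP
  have : IsProbabilityMeasure P := Measure.isProbabilityMeasure_map hpath.aemeasurable
  have hpc := continuous_pathMap hcont
  have hpm := measurable_pathMap hcont hmeas
  have hlip' : meanLogPos P (fun v => lipCoeff (pathMap hcont v)) < ∞ := by
    rw [meanLogPos_map hpath (measurable_lipCoeff hpc hpm)]
    exact hlip
  have hcontr' : MeanLogNegative P fun v =>
      lipCoeff (pastIterate (fun t => pathMap hcont (shiftBy t v)) 0 r) := by
    rw [meanLogNegative_map hpath (measurable_lipCoeff
      (fun v => continuous_pastIterate (fun t => hpc _) 0 r)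
      (measurable_pastIterate (fun t v => hpc _) (fun t x => (hpm x).comp (measurable_shiftBy t)) 0 r))]
    simp only [pathMap_shiftBy]
    exact hcontr
  have hinit' : meanLogPos P (fun v => edist (pathMap hcont v (ContinuousMap.const K ς))
      (ContinuousMap.const K (WithLp.toLp 2 0))) < ∞ := by
    rw [meanLogPos_map hpath ((hpm _).edist measurable_const)]
    exact hinit
  -- The backward limit along the observed path is a stationary solution, so the identifiability
  -- hypothesis applies to it and hence to `predVol`.
  have hstat : IsStationarySRESolution μ g K hcont X
      fun t ω => statVol hcont ς (shiftBy t (obsPath X σ ω)) := by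
    refine ⟨isStationarySeq_comp_shiftBy hXm hP.toMeasurePreserving
      (measurable_statVol hcont ς hmeas), fun t => ?_⟩
    filter_upwards [ae_of_ae_map hpath.aemeasurable
      (ae_backwardLimit_succ hP hpc hpm hlip' hr hcontr' hinit')] with ω hω
    have h := hω t
    rw [pathMap_shiftBy] at h
    exact h
  let η : K := ⟨θ₀, hθ₀⟩
  obtain ⟨hfin, hlt⟩ := lintegral_contrast_lt (θ₀ := η) hZ hmod hlog hmeas hcont ς hc hlow
    fun θ => (hident _ hstat θ).trans (Subtype.ext_iff (a1 := θ) (a2 := η)).symm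
  have hnn := contrast_nonneg hcont ς hc hlow
  have hint : Integrable (fun v => contrast hcont ς c v η) P :=
    ⟨(measurable_contrast hcont ς hmeas η).aestronglyMeasurable,
      (hasFiniteIntegral_iff_ofReal (ae_of_all _ fun v => hnn v η)).2 hfin.lt_top⟩
  have h1 := ae_forall_tendsto_of_contrast hP (continuous_contrast hcont ς hc hlow)
    (measurable_contrast hcont ς hmeas) hnn hint hlt
  have h2 := ae_abs_quasiLogLik_add_le hcont ς hP hmeas hlip' hr hcontr' hinit'
    (integrable_log_obs_of_contrast hcont ς hc hlow hint) hc hlow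
  have h3 : ∀ᵐ ω ∂μ, ∀ n, 1 ≤ n → ∀ θ : K,
      quasiLogLik g K hcont X ς n ω θ ≤ quasiLogLik g K hcont X ς n ω (θhat n ω) :=
    ae_all_iff.2 fun n => eventually_imp_distrib_left.2 (hθhat n)
  filter_upwards [ae_of_ae_map hpath.aemeasurable h1, ae_of_ae_map hpath.aemeasurable h2, h3]
    with ω k1 ⟨C, k2⟩ k3
  -- The bounded discrepancy enters twice, at `θhat n ω` and at `η`; hence maximizing the likelihood
  -- minimizes the stationary contrast up to `2 * C`.
  refine (continuous_subtype_val.tendsto η).comp (k1 (fun n => θhat n ω) ⟨2 * C, fun n hn => ?_⟩)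
  have e1 := (abs_le.1 (k2 n (θhat n ω))).2
  have e2 := (abs_le.1 (k2 n η)).1
  have e3 := k3 n hn η
  rw [quasiLogLik_obsPath] at e1 e2
  linarith
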